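/- **Conventions.** For all $d\geq 0$, $\mathbb{R}^d$ carries the $\ell^\infty$ norm; linear and multilinear maps carry the corresponding operator norms, and $B(x,r)$ is the open ball. Let $m\in\mathbb{N}$, $\varepsilon\in(0,1]$, let $E,F$ be normed spaces and $S\subseteq E$. A map $f:S\to F$ is $\mathrm{Lip}\text{-}(m+\varepsilon)$ if there are a constant $M\ge 0$, maps $f^0=f,f^1,\dots,f^m$ on $S$, where $f^j(x)$ is a symmetric $j$-linear map from $E$ to $F$, and $j$-linear maps $R_j(x,y)$, such that for all $0\le j\le m$, $x,y\in S$ and $v\in E^{j}$ $$\|f^j(x)\|\le M,\qquad f^j(x)(v)=\sum_{l=j}^m \frac{1}{(l-j)!}f^l(y)\bigl(v,\underbrace{x-y,\dots,x-y}_{l-j}\bigr)+R_j(x,y)(v),\qquad \|R_j(x,y)\|\le M\|x-y\|^{m+\varepsilon-j}.$$ The smallest such $M$ is the norm $\|f\|_{\mathrm{Lip}\text{-}(m+\varepsilon)}$. (If $S$ is open, then $f^1,\dots,f^m$ are the derivatives of $f$.) A $\mathrm{Lip}\text{-}(m+\varepsilon)$ diffeomorphism is a $\mathrm{Lip}\text{-}(m+\varepsilon)$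 bijection whose inverse is $\mathrm{Lip}\text{-}(m+\varepsilon)$. **Theorem (Constant Rank).** Let $n\ge 1$ be an integer, $\varepsilon\in(0,1]$ and $M_1,M_2>0$. There exist constants $\delta>0$ and $c>0$, depending only on $n,\varepsilon,M_1,M_2$, with the following property. Let $p,q\ge 1$ and $k\ge 0$ be integers, $U\subseteq\mathbb{R}^p$ open, and $\varphi=(\varphi_1,\dots,\varphi_q):U\to\mathbb{R}^q$ a differentiable map whose derivative $\mathrm{d}\varphi(x)$ has rank $k$ at every $x\in U$, such that $\mathrm{d}\varphi$ is $\mathrm{Lip}\text{-}(n+\varepsilon-1)$ on $U$ with $\|\mathrm{d}\varphi\|_{\mathrm{Lip}\text{-}(n+\varepsilon-1)}\le M_1$. Let $x_0\in U$, $1\le i_1<\dots<i_k\le q$ and $1\le j_1<\dots<j_k\le p$ be such that $M=\bigl(\frac{\partial\varphi_{i_r}}{\partial x_{j_l}}(x_0)\bigr)_{1\le r,l\le k}$ is invertible with $\|M^{-1}\|\le M_2$. Then for every $\alpha\in(0,\delta]$ with $\overline{B(x_0,\alpha)}\subseteq U$ there are - open sets $U_0,H\subseteq\mathbb{R}^p$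 with $B(x_0,\alpha/3)\subseteq U_0\subseteq U$ and a $\mathrm{Lip}\text{-}(n+\varepsilon)$ diffeomorphism $f:U_0\to H$ with $f(x_0)=0$; - an open set $W\subseteq\mathbb{R}^q$ containing $\varphi(U_0)$ and a $\mathcal{C}^n$ diffeomorphism $g$ from $W$ onto an open subset of $\mathbb{R}^q$ with $g(\varphi(x_0))=0$, such that $\mathrm{d}g$ is $\mathrm{Lip}\text{-}(n+\varepsilon-1)$ on $W$ and the restriction of $g$ to $\varphi(U_0)$, and to any bounded subset of $W$, is $\mathrm{Lip}\text{-}(n+\varepsilon)$; such that for all $x=(x_1,\dots,x_p)\in H$ $$g\circ\varphi\circ f^{-1}(x_1,\dots,x_p)=(x_1,\dots,x_k,0,\dots,0)\in\mathbb{R}^q.$$ Moreover, if $k=p$, then $\varphi|_{U_0}$ is injective, $\mathrm{d}\varphi(x)$ is injective for every $x\in U_0$, and there is a differentiable map $\hat\varphi:V\to\mathbb{R}^p$ on an open set $V\supseteq\varphi(U_0)$ with $\hat\varphi(\varphi(x))=x$ for all $x\in U_0$, which is $\mathrm{Lip}\text{-}(n+\varepsilon)$ on $V$, and whose derivative is $\mathrm{Lip}\text{-}(n+\varepsilon-1)$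 on $V$ with $$\|\mathrm{d}\hat\varphi\|_{\mathrm{Lip}\text{-}(n+\varepsilon-1)}\le c\,\|\mathrm{d}\varphi\|_{\mathrm{Lip}\text{-}(n+\varepsilon-1)},$$ where the norms are taken on $V$ and on $U$ respectively. -/

import Mathlib

section LipschitzMaps

variable {E F : Type*} [NormedAddCommGroup E] [NormedSpace ℝ E]
  [NormedAddCommGroup F] [NormedSpace ℝ F]

/-- The tuple `(v₁, …, v_k, h, …, h)` of length `j`, standing for the elementary tensor
`v ⊗ h^{⊗ (j - k)}` with `v = v₁ ⊗ ⋯ ⊗ v_k` (used for `k ≤ j` only). -/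
def padTuple {k : ℕ} (j : ℕ) (v : Fin k → E) (h : E) : Fin j → E :=
  fun i => if hi : i.1 < k then v ⟨i.1, hi⟩ else h

/-- The collection `(J · 0, …, J · n)` of maps with values in the symmetric `k`-linear maps is
Lipschitz of degree `n + ε` on `S` with constant `M`. A `k`-linear map carries its operator norm.
Only the terms of order `k ≤ n` at the points of `S` matter. -/
structure IsLipJet (n : ℕ) (ε M : ℝ) (J : E → FormalMultilinearSeries ℝ E F) (S : Set E) :
    Prop where
  symm : ∀ k ≤ n, ∀ x ∈ S, ∀ (σ : Equiv.Perm (Fin k)) (v : Fin k → E),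
    J x k (fun i => v (σ i)) = J x k v
  bound : ∀ k ≤ n, ∀ x ∈ S, ‖J x k‖ ≤ M
  taylor : ∃ R : E → E → FormalMultilinearSeries ℝ E F, ∀ k ≤ n, ∀ x ∈ S, ∀ y ∈ S,
    (∀ v : Fin k → E, J x k v =
      (∑ j ∈ Finset.Icc k n, ((j - k).factorial : ℝ)⁻¹ • J y j (padTuple j v (x - y)))
        + R x y k v) ∧
    ‖R x y k‖ ≤ M * ‖x - y‖ ^ ((n : ℝ) + ε - (k : ℝ))

/-- `f` is the zeroth term of some Lipschitz collection of degree `n + ε` on `S`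
with constant `M`. -/
def IsLipWith (n : ℕ) (ε M : ℝ) (f : E → F) (S : Set E) : Prop :=
  ∃ J : E → FormalMultilinearSeries ℝ E F,
    (∀ x ∈ S, (J x 0).curry0 = f x) ∧ IsLipJet n ε M J S

/-- `f` is `Lip-(n + ε)` on `S`. -/
def IsLip (n : ℕ) (ε : ℝ) (f : E → F) (S : Set E) : Prop :=
  ∃ M : ℝ, IsLipWith n ε M f S

/-- The `Lip-(n + ε)` norm of `f` on `S`, the smallest admissible constant (meaningful when `f`
is `Lip-(n + ε)` on `S`). On an open set the higher order terms are the derivatives of `f`, so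
that there is only one collection to consider. -/
noncomputable def lipNorm (n : ℕ) (ε : ℝ) (f : E → F) (S : Set E) : ℝ :=
  sInf {M : ℝ | 0 ≤ M ∧ IsLipWith n ε M f S}

/-- `f : U → V` is a bijection with inverse `f' : V → U`, and both are `Lip-(n + ε)`. -/
structure IsLipDiffeo (n : ℕ) (ε : ℝ) (f : E → F) (f' : F → E) (U : Set E) (V : Set F) :
    Prop where
  mapsTo : Set.MapsTo f U V
  mapsTo_inv : Set.MapsTo f' V U
  invOn : Set.InvOn f' f U V
  lip : IsLip n ε f U
  lip_inv : IsLip n ε f' V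

/-- `f : U → V` is a diffeomorphism of class `C^n` between open sets, with inverse `f'`. -/
structure IsDiffeo (n : ℕ) (f : E → F) (f' : F → E) (U : Set E) (V : Set F) : Prop where
  isOpen_source : IsOpen U
  isOpen_target : IsOpen V
  mapsTo : Set.MapsTo f U V
  mapsTo_inv : Set.MapsTo f' V U
  invOn : Set.InvOn f' f U V
  contDiffOn : ContDiffOn ℝ (n : WithTop ℕ∞) f U
  contDiffOn_inv : ContDiffOn ℝ (n : WithTop ℕ∞) f' V

end LipschitzMaps

/-- The minor `(∂φ_{i_r} / ∂x_{j_l} (x))_{r, l}`. The spaces `Fin p → ℝ` carry the sup norm. -/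
noncomputable def jacobianMinor {p q k : ℕ} (φ : (Fin p → ℝ) → (Fin q → ℝ)) (x : Fin p → ℝ)
    (i : Fin k → Fin q) (j : Fin k → Fin p) : Matrix (Fin k) (Fin k) ℝ :=
  Matrix.of fun r l => fderiv ℝ φ x (Pi.single (j l) 1) (i r)

/-- The norm of a square matrix subordinate to the sup norm. -/
noncomputable def subordinateNorm {k : ℕ} (A : Matrix (Fin k) (Fin k) ℝ) : ℝ :=
  ‖LinearMap.toContinuousLinearMap (Matrix.toLin' A)‖

/-- The map `(x₁, …, x_p) ↦ (x₁, …, x_k, 0, …, 0)` from `ℝ^p` to `ℝ^q`, for `k ≤ p` and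
`k ≤ q`. -/
def firstCoords (p q k : ℕ) (x : Fin p → ℝ) : Fin q → ℝ :=
  fun i => if h : i.1 < k ∧ i.1 < p then x ⟨i.1, h.2⟩ else 0

/-!
Let `u` be the part of `φ` made of the coordinates `i₁, …, i_k`, and let `h` be the map which
replaces the coordinates `j₁, …, j_k` of `x - x₀` by `u x - u x₀`. The bound on the inverse of the
minor yields a bound on the inverse of `L = dh(x₀)`, and the Hölder bound on `dφ` shows that
`L⁻¹ ∘ dh` is within `1/4` of the identity on a ball whose radius depends only on the given
constants. So `h` has an inverse with uniform bounds on a neighbourhood of `x₀` of uniform size.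

In the chart `f = h` the coordinates `i₁, …, i_k` of `φ ∘ f⁻¹` are, up to a constant, the first `k`
coordinates of the argument. As the rank is `k`, the derivative of `φ ∘ f⁻¹` then vanishes in the
remaining directions, whence `φ ∘ f⁻¹ = Ψ ∘ proj` on a convex set, and `g` subtracts the graph
of `Ψ`. If `k = p`, then `u` alone determines `x`, and `f⁻¹` composed with `u` on the target side
is the left inverse.

For the estimates, the class `Lip-(m + ε)` is compared, by Taylor's formula on convex sets, with
the class of maps having bounded derivatives up to order `m`, the last one `ε`-Hölder. As
`d(f⁻¹) = (df)⁻¹ ∘ f⁻¹`, the bounds on products, compositions and inverses in this class follow by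
induction on `m`.
-/

universe u

section HolderCalculus

variable {E F G H : Type u} [NormedAddCommGroup E] [NormedSpace ℝ E] [NormedAddCommGroup F]
  [NormedSpace ℝ F] [NormedAddCommGroup G] [NormedSpace ℝ G] [NormedAddCommGroup H]
  [NormedSpace ℝ H] {ε C C' K : ℝ} {m : ℕ} {S S' : Set E} {T : Set F} {f g : E → F}

/-- `f` is `m` times differentiable on `S` (meant to be open), `f` and its derivatives up to order
`m` are bounded by `C`, and the derivative of order `m` is `ε`-Hölder with constant `C`. On convex
open sets this is, up to constants, the class `Lip-(m + ε)`, but it is stable under calculus by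
plain induction on `m`. -/
def HolderClass (ε C : ℝ) {E : Type u} [NormedAddCommGroup E] [NormedSpace ℝ E] :
    ℕ → ∀ {F : Type u} [NormedAddCommGroup F] [NormedSpace ℝ F], (E → F) → Set E → Prop
  | 0, _, _, _, f, S => (∀ x ∈ S, ‖f x‖ ≤ C) ∧ ∀ x ∈ S, ∀ y ∈ S, ‖f x - f y‖ ≤ C * ‖x - y‖ ^ ε
  | m + 1, _, _, _, f, S => (∀ x ∈ S, ‖f x‖ ≤ C) ∧ DifferentiableOn ℝ f S ∧
      HolderClass ε C m (fderiv ℝ f) S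

/-- The analogue of `HolderClass` without a bound on the size of `f` itself: for `m = 0` the map
is `C`-Lipschitz, for `m > 0` it is differentiable and its derivative is of Hölder class `m - 1`.
These are the inner maps in compositions. -/
def LipClass (ε C : ℝ) : ℕ → (E → F) → Set E → Prop
  | 0, f, S => ∀ x ∈ S, ∀ y ∈ S, ‖f x - f y‖ ≤ C * ‖x - y‖
  | m + 1, f, S => DifferentiableOn ℝ f S ∧ HolderClass ε C m (fderiv ℝ f) S

theorem HolderClass.norm_le (h : HolderClass ε C m f S) : ∀ x ∈ S, ‖f x‖ ≤ C := by
  cases m <;> exact h.1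

theorem HolderClass.lipClass (h : HolderClass ε C (m + 1) f S) : LipClass ε C (m + 1) f S := h.2

theorem HolderClass.mono_const (hC : C ≤ C') (h : HolderClass ε C m f S) :
    HolderClass ε C' m f S := by
  induction m generalizing F with
  | zero =>
    exact ⟨fun x hx => (h.1 x hx).trans hC, fun x hx y hy => (h.2 x hx y hy).trans (by gcongr)⟩
  | succ m ih => exact ⟨fun x hx => (h.1 x hx).trans hC, h.2.1, ih h.2.2⟩

theorem HolderClass.mono_set (hS : S' ⊆ S) (h : HolderClass ε C m f S) :
    HolderClass ε C m f S' := by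
  induction m generalizing F with
  | zero => exact ⟨fun x hx => h.1 x (hS hx), fun x hx y hy => h.2 x (hS hx) y (hS hy)⟩
  | succ m ih => exact ⟨fun x hx => h.1 x (hS hx), h.2.1.mono hS, ih h.2.2⟩

theorem LipClass.mono_set (hS : S' ⊆ S) (h : LipClass ε C m f S) : LipClass ε C m f S' := by
  cases m with
  | zero => exact fun x hx y hy => h x (hS hx) y (hS hy)
  | succ m => exact ⟨h.1.mono hS, h.2.mono_set hS⟩

theorem LipClass.differentiableAt (hS : IsOpen S) (h : LipClass ε C (m + 1) f S) {x : E}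
    (hx : x ∈ S) : DifferentiableAt ℝ f x :=
  (h.1 x hx).differentiableAt (hS.mem_nhds hx)

theorem HolderClass.differentiableAt (hS : IsOpen S) (h : HolderClass ε C (m + 1) f S) {x : E}
    (hx : x ∈ S) : DifferentiableAt ℝ f x :=
  h.lipClass.differentiableAt hS hx

theorem LipClass.norm_sub_le (hS : IsOpen S) (hconv : Convex ℝ S) (h : LipClass ε C (m + 1) f S) :
    ∀ x ∈ S, ∀ y ∈ S, ‖f x - f y‖ ≤ C * ‖x - y‖ := fun _ hx _ hy =>
  hconv.norm_image_sub_le_of_norm_fderiv_le (fun _ => h.differentiableAt hS) h.2.norm_le hy hx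

theorem HolderClass.congr (hS : IsOpen S) (h : HolderClass ε C m f S) (hfg : Set.EqOn g f S) :
    HolderClass ε C m g S := by
  induction m generalizing F with
  | zero =>
    refine ⟨fun x hx => hfg hx ▸ h.1 x hx, fun x hx y hy => ?_⟩
    rw [hfg hx, hfg hy]
    exact h.2 x hx y hy
  | succ m ih =>
    refine ⟨fun x hx => hfg hx ▸ h.1 x hx, h.2.1.congr hfg, ih h.2.2 fun x hx => ?_⟩
    exact (Filter.eventuallyEq_of_mem (hS.mem_nhds hx) hfg).fderiv_eq

theorem continuousOn_of_norm_sub_le_rpow {E F : Type*} [SeminormedAddCommGroup E]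
    [SeminormedAddCommGroup F] {f : E → F} {S : Set E} (hε : 0 < ε)
    (h : ∀ x ∈ S, ∀ y ∈ S, ‖f x - f y‖ ≤ C * ‖x - y‖ ^ ε) : ContinuousOn f S := by
  intro x hx
  have hmodulus : Continuous fun y : E => C * ‖y - x‖ ^ ε :=
    continuous_const.mul ((continuous_id.sub continuous_const).norm.rpow_const
      fun _ => Or.inr hε.le)
  have hlim : Filter.Tendsto (fun y => C * ‖y - x‖ ^ ε) (nhdsWithin x S) (nhds 0) := by
    simpa [Real.zero_rpow hε.ne'] using (hmodulus.tendsto x).mono_left nhdsWithin_le_nhds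
  rw [ContinuousWithinAt, tendsto_iff_norm_sub_tendsto_zero]
  exact squeeze_zero' (.of_forall fun _ => norm_nonneg _)
    (Filter.eventually_of_mem self_mem_nhdsWithin fun y hy => h y hy x hx) hlim

theorem HolderClass.contDiffOn (hε : 0 < ε) (hS : IsOpen S) (h : HolderClass ε C m f S) :
    ContDiffOn ℝ (m : WithTop ℕ∞) f S := by
  induction m generalizing F with
  | zero => exact contDiffOn_zero.2 (continuousOn_of_norm_sub_le_rpow hε h.2)
  | succ m ih =>
    rw [Nat.cast_add, Nat.cast_one, contDiffOn_succ_iff_fderiv_of_isOpen hS]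
    exact ⟨h.2.1, fun h => absurd h (by simp), ih h.2.2⟩

theorem HolderClass.const (hC : 0 ≤ C) {c : F} (hc : ‖c‖ ≤ C) :
    HolderClass ε C m (fun _ : E => c) S := by
  induction m generalizing F with
  | zero => exact ⟨fun x _ => hc, fun x _ y _ => by simpa using by positivity⟩
  | succ m ih =>
    refine ⟨fun x _ => hc, differentiableOn_const c, ?_⟩
    rw [fderiv_fun_const]
    exact ih (norm_zero.trans_le hC)

theorem LipClass.affine (hC : 0 ≤ C) (A : E →L[ℝ] F) (hA : ‖A‖ ≤ C) (c : F) :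
    LipClass ε C (m + 1) (fun x => A x + c) S := by
  have h : ∀ x, HasFDerivAt (fun x => A x + c) A x := fun x => A.hasFDerivAt.add_const c
  refine ⟨fun x _ => (h x).differentiableAt.differentiableWithinAt, ?_⟩
  rw [show fderiv ℝ (fun x => A x + c) = fun _ => A from funext fun x => (h x).fderiv]
  exact HolderClass.const hC hA

theorem HolderClass.add (hS : IsOpen S) (hf : HolderClass ε C m f S)
    (hg : HolderClass ε C' m g S) : HolderClass ε (C + C') m (fun x => f x + g x) S := by
  have hbound : ∀ x ∈ S, ‖f x + g x‖ ≤ C + C' := fun x hx =>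
    norm_add_le_of_le (hf.norm_le x hx) (hg.norm_le x hx)
  induction m generalizing F with
  | zero =>
    refine ⟨hbound, fun x hx y hy => ?_⟩
    rw [add_sub_add_comm, add_mul]
    exact norm_add_le_of_le (hf.2 x hx y hy) (hg.2 x hx y hy)
  | succ m ih =>
    refine ⟨hbound, hf.2.1.add hg.2.1, (ih hf.2.2 hg.2.2 fun x hx =>
      norm_add_le_of_le (hf.2.2.norm_le x hx) (hg.2.2.norm_le x hx)).congr hS fun x hx => ?_⟩
    exact fderiv_fun_add (hf.differentiableAt hS hx) (hg.differentiableAt hS hx)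

theorem norm_compL_apply_le (A : F →L[ℝ] G) : ‖ContinuousLinearMap.compL ℝ E F G A‖ ≤ ‖A‖ :=
  ContinuousLinearMap.opNorm_le_bound _ (norm_nonneg _) A.opNorm_comp_le

theorem HolderClass.clm_comp (hS : IsOpen S) (hf : HolderClass ε C m f S) (A : F →L[ℝ] G)
    (hA : ‖A‖ ≤ K) : HolderClass ε (K * C) m (fun x => A (f x)) S := by
  induction m generalizing F G with
  | zero =>
    refine ⟨fun x hx => A.le_of_opNorm_le_of_le hA (hf.1 x hx), fun x hx y hy => ?_⟩
    rw [← map_sub, mul_assoc]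
    exact A.le_of_opNorm_le_of_le hA (hf.2 x hx y hy)
  | succ m ih =>
    refine ⟨fun x hx => A.le_of_opNorm_le_of_le hA (hf.1 x hx),
      A.differentiable.comp_differentiableOn hf.2.1, ?_⟩
    refine (ih hf.2.2 (ContinuousLinearMap.compL ℝ E F G A)
      ((norm_compL_apply_le A).trans hA)).congr hS fun x hx => ?_
    exact (A.hasFDerivAt.comp x (hf.differentiableAt hS hx).hasFDerivAt).fderiv

theorem LipClass.clm_comp (hS : IsOpen S) (hf : LipClass ε C (m + 1) f S) (A : F →L[ℝ] G)
    (hA : ‖A‖ ≤ K) : LipClass ε (K * C) (m + 1) (fun x => A (f x)) S :=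
  ⟨A.differentiable.comp_differentiableOn hf.1,
    (hf.2.clm_comp hS (ContinuousLinearMap.compL ℝ E F G A)
      ((norm_compL_apply_le A).trans hA)).congr hS
        fun x hx => (A.hasFDerivAt.comp x (hf.differentiableAt hS hx).hasFDerivAt).fderiv⟩

theorem HolderClass.neg (hS : IsOpen S) (hf : HolderClass ε C m f S) :
    HolderClass ε C m (fun x => -f x) S := by
  simpa using hf.clm_comp hS (-ContinuousLinearMap.id ℝ F)
    ((norm_neg _).trans_le ContinuousLinearMap.norm_id_le)

theorem LipClass.add (hS : IsOpen S) (hf : LipClass ε C (m + 1) f S)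
    (hg : LipClass ε C' (m + 1) g S) : LipClass ε (C + C') (m + 1) (fun x => f x + g x) S :=
  ⟨hf.1.add hg.1, (hf.2.add hS hg.2).congr hS fun _ hx =>
    fderiv_fun_add (hf.differentiableAt hS hx) (hg.differentiableAt hS hx)⟩

theorem LipClass.holderClass (hf : LipClass ε C (m + 1) f S) (hK : ∀ x ∈ S, ‖f x‖ ≤ K) :
    HolderClass ε (max K C) (m + 1) f S :=
  ⟨fun x hx => (hK x hx).trans (le_max_left _ _), hf.1, hf.2.mono_const (le_max_right _ _)⟩

theorem LipClass.exists_holderClass (hS : IsOpen S) (hconv : Convex ℝ S)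
    (hb : Bornology.IsBounded S) (hf : LipClass ε C (m + 1) f S) :
    ∃ C', 0 ≤ C' ∧ HolderClass ε C' (m + 1) f S := by
  rcases S.eq_empty_or_nonempty with rfl | ⟨x₀, hx₀⟩
  · exact ⟨max 0 C, le_max_left _ _, hf.holderClass (by simp)⟩
  obtain ⟨R, hR⟩ := (Metric.isBounded_iff_subset_closedBall x₀).1 hb
  have hC : 0 ≤ C := (norm_nonneg _).trans (hf.2.norm_le x₀ hx₀)
  refine ⟨max (‖f x₀‖ + C * R) C, le_max_of_le_right hC, hf.holderClass fun x hx => ?_⟩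
  calc ‖f x‖ ≤ ‖f x₀‖ + ‖f x - f x₀‖ := norm_le_norm_add_norm_sub' _ _
    _ ≤ ‖f x₀‖ + C * ‖x - x₀‖ := by gcongr; exact hf.norm_sub_le hS hconv x hx x₀ hx₀
    _ ≤ ‖f x₀‖ + C * R := by gcongr; exact mem_closedBall_iff_norm.1 (hR hx)

theorem le_two_mul_mul_rpow {a d : ℝ} (hε₀ : 0 < ε) (hε₁ : ε ≤ 1) (hC : 0 ≤ C) (hd : 0 ≤ d)
    (hlip : a ≤ C * d) (hbound : a ≤ 2 * C) : a ≤ 2 * C * d ^ ε := by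
  rcases le_total d 1 with h | h
  · have : d ≤ d ^ ε := Real.self_le_rpow_of_le_one hd h hε₁
    nlinarith [mul_le_mul_of_nonneg_left this hC, mul_nonneg hC (Real.rpow_nonneg hd ε)]
  · have : 1 ≤ d ^ ε := Real.one_le_rpow h hε₀.le
    nlinarith

theorem HolderClass.of_succ (hε₀ : 0 < ε) (hε₁ : ε ≤ 1) (hS : IsOpen S) (hconv : Convex ℝ S)
    (h : HolderClass ε C (m + 1) f S) : HolderClass ε (2 * C) m f S := by
  have hbound : ∀ x ∈ S, ‖f x‖ ≤ 2 * C := fun x hx => by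
    linarith [h.1 x hx, norm_nonneg (f x)]
  induction m generalizing F with
  | zero =>
    refine ⟨hbound, fun x hx y hy => ?_⟩
    have hC : 0 ≤ C := (norm_nonneg _).trans (h.1 x hx)
    refine le_two_mul_mul_rpow hε₀ hε₁ hC (norm_nonneg _)
      (h.lipClass.norm_sub_le hS hconv x hx y hy) ?_
    linarith [norm_sub_le (f x) (f y), h.1 x hx, h.1 y hy]
  | succ m ih =>
    refine ⟨hbound, h.2.1, ih h.2.2 fun x hx => ?_⟩
    linarith [h.2.2.1 x hx, norm_nonneg (fderiv ℝ f x)]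

theorem HolderClass.zero (hε₀ : 0 < ε) (hε₁ : ε ≤ 1) (hS : IsOpen S) (hconv : Convex ℝ S)
    (h : HolderClass ε C m f S) : HolderClass ε (2 ^ m * C) 0 f S := by
  induction m generalizing C with
  | zero => simpa using h
  | succ m ih => simpa [pow_succ, mul_assoc] using ih (h.of_succ hε₀ hε₁ hS hconv)

theorem LipClass.of_succ (hε₀ : 0 < ε) (hε₁ : ε ≤ 1) (hS : IsOpen S) (hconv : Convex ℝ S)
    (h : LipClass ε C (m + 1) f S) : LipClass ε (2 * C) m f S := by
  cases m with
  | zero =>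
    intro x hx y hy
    have hC : 0 ≤ C := (norm_nonneg _).trans (h.2.norm_le x hx)
    exact (h.norm_sub_le hS hconv x hx y hy).trans (by gcongr; linarith)
  | succ m => exact ⟨h.1, h.2.of_succ hε₀ hε₁ hS hconv⟩

theorem norm_apply₂_le_mul_four_pow (B : F →L[ℝ] G →L[ℝ] H) (hB : ‖B‖ ≤ K) {a : F} {b : G}
    (ha : ‖a‖ ≤ C) (hb : ‖b‖ ≤ C') (m : ℕ) : ‖B a b‖ ≤ 2 * 4 ^ m * K * C * C' := by
  have hKCC' : 0 ≤ K * C * C' := mul_nonneg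
    (mul_nonneg ((norm_nonneg B).trans hB) ((norm_nonneg a).trans ha)) ((norm_nonneg b).trans hb)
  have hone : (1 : ℝ) ≤ 4 ^ m := one_le_pow₀ (by norm_num)
  nlinarith [B.le_of_opNorm₂_le_of_le hB ha hb]

theorem norm_bilinear_sub_le (B : F →L[ℝ] G →L[ℝ] H) (hB : ‖B‖ ≤ K) {a a' : F} {b b' : G} {r : ℝ}
    (ha' : ‖a'‖ ≤ C) (hb : ‖b‖ ≤ C') (haa' : ‖a - a'‖ ≤ C * r) (hbb' : ‖b - b'‖ ≤ C' * r) :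
    ‖B a b - B a' b'‖ ≤ 2 * K * C * C' * r := by
  have hsplit : B a b - B a' b' = B (a - a') b + B a' (b - b') := by simp
  rw [hsplit]
  calc ‖B (a - a') b + B a' (b - b')‖
      ≤ K * (C * r) * C' + K * C * (C' * r) := norm_add_le_of_le
        ((B (a - a')).le_of_opNorm_le_of_le (B.le_of_opNorm_le_of_le hB haa') hb)
        ((B a').le_of_opNorm_le_of_le (B.le_of_opNorm_le_of_le hB ha') hbb')
    _ = 2 * K * C * C' * r := by ring

theorem HolderClass.bilinear {g : E → G} (hε₀ : 0 < ε) (hε₁ : ε ≤ 1) (hS : IsOpen S)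
    (hconv : Convex ℝ S) (hf : HolderClass ε C m f S) (hg : HolderClass ε C' m g S)
    (B : F →L[ℝ] G →L[ℝ] H) (hB : ‖B‖ ≤ K) :
    HolderClass ε (2 * 4 ^ m * K * C * C') m (fun x => B (f x) (g x)) S := by
  induction m generalizing F G H C C' with
  | zero =>
    refine ⟨fun x hx => norm_apply₂_le_mul_four_pow B hB (hf.1 x hx) (hg.1 x hx) 0,
      fun x hx y hy => ?_⟩
    simpa using norm_bilinear_sub_le B hB (hf.1 y hy) (hg.1 x hx) (hf.2 x hx y hy)
      (hg.2 x hx y hy)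
  | succ m ih =>
    refine ⟨fun x hx => norm_apply₂_le_mul_four_pow B hB (hf.1 x hx) (hg.1 x hx) _,
      fun x hx => (B.hasFDerivAt_of_bilinear (hf.differentiableAt hS hx).hasFDerivAt
        (hg.differentiableAt hS hx).hasFDerivAt).differentiableAt.differentiableWithinAt, ?_⟩
    have hfg' := ih (hf.of_succ hε₀ hε₁ hS hconv) hg.2.2 (B.precompR E)
      ((B.norm_precompR_le E).trans hB)
    have hf'g := ih hf.2.2 (hg.of_succ hε₀ hε₁ hS hconv) (B.precompL E)
      ((B.norm_precompL_le E).trans hB)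
    convert (hfg'.add hS hf'g).congr hS fun x hx =>
      B.fderiv_of_bilinear (hf.differentiableAt hS hx) (hg.differentiableAt hS hx) using 1
    ring

theorem HolderClass.fderiv_comp {g : F → G} (hε₀ : 0 < ε) (hε₁ : ε ≤ 1) (hS : IsOpen S)
    (hconv : Convex ℝ S) (hT : IsOpen T) (hg : DifferentiableOn ℝ g T) (hmaps : Set.MapsTo f S T)
    (hg' : HolderClass ε C m (fun x => fderiv ℝ g (f x)) S) (hf : LipClass ε C' (m + 1) f S) :
    HolderClass ε (2 * 4 ^ m * C * C') m (fderiv ℝ fun x => g (f x)) S := by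
  have hprod := hg'.bilinear hε₀ hε₁ hS hconv hf.2 (ContinuousLinearMap.compL ℝ E F G)
    (ContinuousLinearMap.norm_compL_le ℝ E F G)
  rw [mul_one] at hprod
  exact hprod.congr hS fun x hx => _root_.fderiv_comp x
    (hg.differentiableAt (hT.mem_nhds (hmaps hx))) (hf.differentiableAt hS hx)

/-- The constant of the composition of a map of Hölder class `m` with constant `C₁` and a map of
Lipschitz class `m` with constant `C₂`. -/
noncomputable def compConst (ε C₁ : ℝ) : ℕ → ℝ → ℝ
  | 0, C₂ => C₁ + C₁ * C₂ ^ ε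
  | m + 1, C₂ => C₁ + 2 * 4 ^ m * compConst ε C₁ m (2 * C₂) * C₂

theorem compConst_nonneg {C₁ C₂ : ℝ} (hC₁ : 0 ≤ C₁) (hC₂ : 0 ≤ C₂) (m : ℕ) :
    0 ≤ compConst ε C₁ m C₂ := by
  induction m generalizing C₂ with
  | zero => unfold compConst; positivity
  | succ m ih =>
    have := ih (C₂ := 2 * C₂) (by positivity)
    unfold compConst
    positivity

theorem HolderClass.comp {g : F → G} {C₁ C₂ : ℝ} (hε₀ : 0 < ε) (hε₁ : ε ≤ 1) (hC₁ : 0 ≤ C₁)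
    (hC₂ : 0 ≤ C₂) (hS : IsOpen S) (hconv : Convex ℝ S) (hT : IsOpen T)
    (hg : HolderClass ε C₁ m g T) (hf : LipClass ε C₂ m f S) (hmaps : Set.MapsTo f S T) :
    HolderClass ε (compConst ε C₁ m C₂) m (fun x => g (f x)) S := by
  induction m generalizing G C₂ with
  | zero =>
    refine ⟨fun x hx => (hg.1 _ (hmaps hx)).trans ?_, fun x hx y hy => ?_⟩
    · exact le_add_of_nonneg_right (by positivity)
    · calc ‖g (f x) - g (f y)‖ ≤ C₁ * ‖f x - f y‖ ^ ε := hg.2 _ (hmaps hx) _ (hmaps hy)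
        _ ≤ C₁ * (C₂ * ‖x - y‖) ^ ε := by gcongr; exact hf x hx y hy
        _ = C₁ * C₂ ^ ε * ‖x - y‖ ^ ε := by
          rw [Real.mul_rpow hC₂ (norm_nonneg _), mul_assoc]
        _ ≤ (C₁ + C₁ * C₂ ^ ε) * ‖x - y‖ ^ ε := by gcongr; linarith
  | succ m ih =>
    have hconst : 0 ≤ 2 * 4 ^ m * compConst ε C₁ m (2 * C₂) * C₂ := by
      have := compConst_nonneg (ε := ε) hC₁ (C₂ := 2 * C₂) (by positivity) m
      positivity
    refine ⟨fun x hx => (hg.1 _ (hmaps hx)).trans (le_add_of_nonneg_right hconst),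
      hg.2.1.comp hf.1 hmaps, ?_⟩
    have hg' := ih (C₂ := 2 * C₂) (by positivity) hg.2.2 (hf.of_succ hε₀ hε₁ hS hconv)
    exact (hg'.fderiv_comp hε₀ hε₁ hS hconv hT hg.2.1 hmaps hf).mono_const
      (le_add_of_nonneg_left hC₁)

section RingInverse

variable {R : Type u} [NormedRing R] [NormedAlgebra ℝ R] [CompleteSpace R] {A : E → R} {C₁ C₂ : ℝ}

/-- The constant of the pointwise inverse, bounded by `C₂`, of a map of Hölder class `m` with
constant `C₁` into a Banach algebra. -/
noncomputable def ringInverseConst (C₂ : ℝ) : ℕ → ℝ → ℝ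
  | 0, C₁ => C₂ + C₂ * C₁ * C₂
  | m + 1, C₁ => C₂ + 2 * 4 ^ m * (2 * 4 ^ m * ringInverseConst C₂ m (2 * C₁) ^ 2) * C₁

theorem ringInverseConst_nonneg (hC₁ : 0 ≤ C₁) (hC₂ : 0 ≤ C₂) (m : ℕ) :
    0 ≤ ringInverseConst C₂ m C₁ := by
  cases m <;> unfold ringInverseConst <;> positivity

theorem norm_ringInverse_sub_le {R : Type*} [NormedRing R] {a b : R} {r : ℝ} (ha : IsUnit a)
    (hb : IsUnit b) (ha' : ‖Ring.inverse a‖ ≤ C) (hb' : ‖Ring.inverse b‖ ≤ C) (hab : ‖a - b‖ ≤ r) :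
    ‖Ring.inverse a - Ring.inverse b‖ ≤ C * r * C := by
  obtain ⟨u, rfl⟩ := ha
  obtain ⟨v, rfl⟩ := hb
  have hresolvent : Ring.inverse (u : R) - Ring.inverse (v : R)
      = Ring.inverse (u : R) * (v - u) * Ring.inverse (v : R) := by
    simp [mul_sub, sub_mul]
  rw [hresolvent]
  refine norm_mul_le_of_le (norm_mul_le_of_le ha' ?_) hb'
  rwa [norm_sub_rev]

theorem hasFDerivAt_comp_ringInverse {x : E} (hA : DifferentiableAt ℝ A x) (hu : IsUnit (A x)) :
    HasFDerivAt (fun x => Ring.inverse (A x))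
      ((-ContinuousLinearMap.mulLeftRight ℝ R (Ring.inverse (A x)) (Ring.inverse (A x))).comp
        (fderiv ℝ A x)) x := by
  obtain ⟨u, hu⟩ := hu
  have hinv := hasFDerivAt_ringInverse (𝕜 := ℝ) u
  rw [hu] at hinv
  simpa [Function.comp_def, ← hu] using hinv.comp x hA.hasFDerivAt

theorem HolderClass.ringInverse (hε₀ : 0 < ε) (hε₁ : ε ≤ 1) (hC₁ : 0 ≤ C₁) (hC₂ : 0 ≤ C₂)
    (hS : IsOpen S) (hconv : Convex ℝ S) (hA : HolderClass ε C₁ m A S)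
    (hunit : ∀ x ∈ S, IsUnit (A x)) (hbound : ∀ x ∈ S, ‖Ring.inverse (A x)‖ ≤ C₂) :
    HolderClass ε (ringInverseConst C₂ m C₁) m (fun x => Ring.inverse (A x)) S := by
  induction m generalizing C₁ with
  | zero =>
    refine ⟨fun x hx => (hbound x hx).trans (le_add_of_nonneg_right (by positivity)),
      fun x hx y hy => ?_⟩
    calc ‖Ring.inverse (A x) - Ring.inverse (A y)‖ ≤ C₂ * (C₁ * ‖x - y‖ ^ ε) * C₂ :=
          norm_ringInverse_sub_le (hunit x hx) (hunit y hy) (hbound x hx) (hbound y hy)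
            (hA.2 x hx y hy)
      _ = C₂ * C₁ * C₂ * ‖x - y‖ ^ ε := by ring
      _ ≤ (C₂ + C₂ * C₁ * C₂) * ‖x - y‖ ^ ε := by gcongr; linarith
  | succ m ih =>
    have hderiv := fun x hx =>
      hasFDerivAt_comp_ringInverse (hA.differentiableAt hS hx) (hunit x hx)
    have hinv := ih (C₁ := 2 * C₁) (by positivity) (hA.of_succ hε₀ hε₁ hS hconv)
    have hconj := hinv.bilinear hε₀ hε₁ hS hconv hinv (ContinuousLinearMap.mulLeftRight ℝ R)
      (ContinuousLinearMap.opNorm_mulLeftRight_le ℝ R)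
    have hprod := hconj.bilinear hε₀ hε₁ hS hconv hA.2.2 (ContinuousLinearMap.compL ℝ E R R)
      (ContinuousLinearMap.norm_compL_le ℝ E R R)
    refine ⟨fun x hx => (hbound x hx).trans (le_add_of_nonneg_right (by positivity)),
      fun x hx => (hderiv x hx).differentiableAt.differentiableWithinAt,
      ((hprod.neg hS).congr hS fun x hx => ?_).mono_const ?_⟩
    · rw [(hderiv x hx).fderiv]
      ext v
      simp
    · rw [ringInverseConst]
      linarith

end RingInverse

theorem HolderClass.of_forall_ball (hε₀ : 0 < ε) {ρ : ℝ} (hρ : 0 < ρ) (hC : 0 ≤ C)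
    (h : ∀ x ∈ S, HolderClass ε C m f (Metric.ball x ρ)) :
    HolderClass ε (C + 2 * C / ρ ^ ε) m f S := by
  have hconst : 0 ≤ 2 * C / ρ ^ ε := by positivity
  have hbound : ∀ x ∈ S, ‖f x‖ ≤ C + 2 * C / ρ ^ ε := fun x hx => by
    linarith [(h x hx).norm_le x (Metric.mem_ball_self hρ)]
  induction m generalizing F with
  | zero =>
    refine ⟨hbound, fun x hx y hy => ?_⟩
    rcases lt_or_ge ‖x - y‖ ρ with hnear | hfar
    · refine ((h y hy).2 x (by simpa [dist_eq_norm] using hnear) y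
        (Metric.mem_ball_self hρ)).trans ?_
      gcongr
      linarith
    · calc ‖f x - f y‖ ≤ C + C := norm_sub_le_of_le ((h x hx).1 x (Metric.mem_ball_self hρ))
            ((h y hy).1 y (Metric.mem_ball_self hρ))
        _ = 2 * C / ρ ^ ε * ρ ^ ε := by
          rw [div_mul_cancel₀ _ (Real.rpow_pos_of_pos hρ ε).ne', two_mul]
        _ ≤ (C + 2 * C / ρ ^ ε) * ‖x - y‖ ^ ε := by gcongr; linarith
  | succ m ih =>
    refine ⟨hbound, fun x hx => ?_, ih (fun x hx => (h x hx).2.2) fun x hx => ?_⟩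
    · exact ((h x hx).differentiableAt Metric.isOpen_ball
        (Metric.mem_ball_self hρ)).differentiableWithinAt
    · linarith [(h x hx).2.2.norm_le x (Metric.mem_ball_self hρ)]

end HolderCalculus

section Symmetry

variable {E F : Type u} [NormedAddCommGroup E] [NormedSpace ℝ E] [NormedAddCommGroup F]
  [NormedSpace ℝ F] {S : Set E} {f : E → F} {m : ℕ} {x : E}

theorem contDiffOn_fderiv (hS : IsOpen S) (hf : ContDiffOn ℝ ((m + 1 : ℕ) : WithTop ℕ∞) f S) :
    ContDiffOn ℝ (m : WithTop ℕ∞) (fderiv ℝ f) S :=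
  hf.fderiv_of_isOpen hS le_rfl

theorem fderiv_fderiv_flip (hS : IsOpen S)
    (hf : ContDiffOn ℝ ((m + 2 : ℕ) : WithTop ℕ∞) f S) :
    Set.EqOn (fun y => (fderiv ℝ (fderiv ℝ f) y).flip) (fderiv ℝ (fderiv ℝ f)) S := by
  intro y hy
  have hsymm : IsSymmSndFDerivAt ℝ f y := (hf.contDiffAt (hS.mem_nhds hy)).isSymmSndFDerivAt
    (by simp)
  ext v w
  exact hsymm w v

theorem iteratedFDeriv_comp_swap_last (hS : IsOpen S)
    (hf : ContDiffOn ℝ ((m + 2 : ℕ) : WithTop ℕ∞) f S) (hx : x ∈ S) (v : Fin (m + 2) → E) :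
    iteratedFDeriv ℝ (m + 2) f x
        (fun i => v (Equiv.swap (Fin.last m).castSucc (Fin.last m).succ i)) =
      iteratedFDeriv ℝ (m + 2) f x v := by
  set D := iteratedFDeriv ℝ m (fderiv ℝ (fderiv ℝ f)) x with hD
  have hflip : ∀ w, (D w).flip = D w := by
    intro w
    let flip : (E →L[ℝ] E →L[ℝ] F) ≃L[ℝ] (E →L[ℝ] E →L[ℝ] F) :=
      (ContinuousLinearMap.flipₗᵢ ℝ E E F).toContinuousLinearEquiv
    have hcomp := ContinuousLinearEquiv.iteratedFDeriv_comp_left (G := E →L[ℝ] E →L[ℝ] F) (𝕜 := ℝ)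
      (f := fderiv ℝ (fderiv ℝ f)) (x := x) (i := m) flip
    have heq : iteratedFDeriv ℝ m (fun y => (fderiv ℝ (fderiv ℝ f) y).flip) x = D :=
      ((Filter.eventuallyEq_of_mem (hS.mem_nhds hx)
        (fderiv_fderiv_flip hS hf)).iteratedFDeriv ℝ m).self_of_nhds
    exact (congrArg (fun A => A w) (hcomp.symm.trans heq) :)
  have hinit : Fin.init (Fin.init fun i =>
      v (Equiv.swap (Fin.last m).castSucc (Fin.last m).succ i)) = Fin.init (Fin.init v) := by
    ext1 i
    refine congrArg v (Equiv.swap_apply_of_ne_of_ne ?_ ?_) <;> simp [Fin.ext_iff, i.2.ne]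
    omega
  simp only [iteratedFDeriv_succ_apply_right, hinit, ← hD]
  simpa [Fin.init] using DFunLike.congr_fun (DFunLike.congr_fun
    (hflip (Fin.init (Fin.init v))) (v (Fin.last m).castSucc)) (v (Fin.last (m + 1)))

theorem iteratedFDeriv_comp_perm_of_contDiffOn (hS : IsOpen S)
    (hf : ContDiffOn ℝ (m : WithTop ℕ∞) f S) (hx : x ∈ S) (σ : Equiv.Perm (Fin m))
    (v : Fin m → E) :
    iteratedFDeriv ℝ m f x (fun i => v (σ i)) = iteratedFDeriv ℝ m f x v := by
  induction m generalizing F with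
  | zero => exact congrArg _ (Subsingleton.elim _ _)
  | succ m ih =>
    have hσ : σ ∈ Submonoid.closure (Set.range fun i : Fin m => Equiv.swap i.castSucc i.succ) := by
      rw [Equiv.Perm.mclosure_swap_castSucc_succ]
      trivial
    induction hσ using Submonoid.closure_induction generalizing v with
    | one => rfl
    | mul σ τ _ _ hσ hτ => exact (hτ fun i => v (σ i)).trans (hσ v)
    | mem σ hσ =>
      obtain ⟨i, rfl⟩ := hσ
      rcases m with - | m
      · exact i.elim0
      induction i using Fin.lastCases with
      | last => exact iteratedFDeriv_comp_swap_last hS hf hx v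
      | cast i =>
        have hlast : Equiv.swap i.castSucc.castSucc i.castSucc.succ (Fin.last (m + 1)) =
            Fin.last (m + 1) := by
          refine Equiv.swap_apply_of_ne_of_ne ?_ ?_ <;> simp [Fin.ext_iff] <;> omega
        have hinit : (Fin.init fun l => v (Equiv.swap i.castSucc.castSucc i.castSucc.succ l)) =
            fun l => Fin.init v (Equiv.swap i.castSucc i.succ l) := by
          ext1 l
          exact congrArg v ((Fin.castSucc_injective _).swap_apply i.castSucc i.succ l)
        rw [iteratedFDeriv_succ_apply_right, iteratedFDeriv_succ_apply_right v, hlast, hinit,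
          ih (contDiffOn_fderiv hS hf)]

theorem iteratedFDeriv_succ_apply_tail (hS : IsOpen S)
    (hf : ContDiffOn ℝ ((m + 1 : ℕ) : WithTop ℕ∞) f S) (hx : x ∈ S) (v : Fin (m + 1) → E) :
    iteratedFDeriv ℝ (m + 1) f x v = iteratedFDeriv ℝ m (fderiv ℝ f) x (Fin.tail v) (v 0) := by
  rw [← iteratedFDeriv_comp_perm_of_contDiffOn hS hf hx (finRotate _) v,
    iteratedFDeriv_succ_apply_right]
  simp only [finRotate_last]
  congr 2
  ext1 l
  simp [Fin.init, Fin.tail]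

end Symmetry

section Taylor

variable {E F : Type u} [NormedAddCommGroup E] [NormedSpace ℝ E] [NormedAddCommGroup F]
  [NormedSpace ℝ F] {S : Set E} {ε C : ℝ} {m : ℕ} {f : E → F} {x y : E}

theorem HolderClass.norm_iteratedFDeriv_le (h : HolderClass ε C m f S) {k : ℕ} (hk : k ≤ m)
    (hx : x ∈ S) : ‖iteratedFDeriv ℝ k f x‖ ≤ C := by
  induction k generalizing m F with
  | zero => simpa using h.norm_le x hx
  | succ k ih =>
    obtain ⟨m, rfl⟩ := Nat.exists_eq_add_of_le' (Nat.one_le_of_lt hk)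
    rw [← norm_iteratedFDeriv_fderiv]
    exact ih h.2.2 (Nat.le_of_succ_le_succ hk)

theorem hasDerivAt_sum_pow_div_factorial_smul (c : ℕ → F) (n : ℕ) (t : ℝ) :
    HasDerivAt (fun t : ℝ => ∑ j ∈ Finset.range (n + 1), (t ^ j * (j.factorial : ℝ)⁻¹) • c j)
      (∑ j ∈ Finset.range n, (t ^ j * (j.factorial : ℝ)⁻¹) • c (j + 1)) t := by
  simp only [Finset.sum_range_succ' _ n, pow_zero]
  refine HasDerivAt.add_const _ (HasDerivAt.fun_sum fun j _ => HasDerivAt.smul_const ?_ _)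
  convert (hasDerivAt_pow (j + 1) t).mul_const (((j + 1).factorial : ℝ)⁻¹) using 1
  rw [Nat.factorial_succ, Nat.add_sub_cancel]
  push_cast
  field_simp

theorem sum_taylor_fderiv_smul_apply (f : E → F) (y w : E) (t : ℝ) (n : ℕ) :
    (∑ j ∈ Finset.range n, (j.factorial : ℝ)⁻¹ •
        iteratedFDeriv ℝ j (fderiv ℝ f) y fun _ => t • w) w =
      ∑ j ∈ Finset.range n, (t ^ j * (j.factorial : ℝ)⁻¹) •
        iteratedFDeriv ℝ (j + 1) f y fun _ => w := by
  rw [_root_.sum_apply]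
  refine Finset.sum_congr rfl fun j _ => ?_
  have hhom := (iteratedFDeriv ℝ j (fderiv ℝ f) y).map_smul_univ (fun _ => t) (fun _ => w)
  rw [Finset.prod_const, Finset.card_univ, Fintype.card_fin] at hhom
  rw [hhom, iteratedFDeriv_succ_apply_right, smul_smul, mul_comm]
  rfl

theorem HolderClass.norm_sub_taylor_le (hε : 0 < ε) (hconv : Convex ℝ S) (hS : IsOpen S)
    (h : HolderClass ε C m f S) (hx : x ∈ S) (hy : y ∈ S) :
    ‖f x - ∑ j ∈ Finset.range (m + 1),
      (j.factorial : ℝ)⁻¹ • iteratedFDeriv ℝ j f y (fun _ => x - y)‖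
      ≤ C * ‖x - y‖ ^ ((m : ℝ) + ε) := by
  induction m generalizing F x with
  | zero => simpa using h.2 x hx y hy
  | succ m ih =>
    have hC : 0 ≤ C := (norm_nonneg _).trans (h.1 x hx)
    obtain ⟨w, rfl⟩ : ∃ w, x = y + w := ⟨x - y, by simp⟩
    have hmem : ∀ t ∈ Set.Icc (0 : ℝ) 1, y + t • w ∈ S := fun t ht =>
      hconv.add_smul_mem hy hx ht
    have hder : ∀ t ∈ Set.Icc (0 : ℝ) 1, HasDerivAt
        (fun t : ℝ => f (y + t • w) - ∑ j ∈ Finset.range (m + 1 + 1),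
          (t ^ j * (j.factorial : ℝ)⁻¹) • iteratedFDeriv ℝ j f y fun _ => w)
        ((fderiv ℝ f (y + t • w) - ∑ j ∈ Finset.range (m + 1), (j.factorial : ℝ)⁻¹ •
          iteratedFDeriv ℝ j (fderiv ℝ f) y fun _ => t • w) w) t := by
      intro t ht
      have hline : HasDerivAt (fun t : ℝ => y + t • w) w t := by
        simpa using ((hasDerivAt_id t).smul_const w).const_add y
      rw [_root_.sub_apply, sum_taylor_fderiv_smul_apply]
      exact ((h.differentiableAt hS (hmem t ht)).hasFDerivAt.comp_hasDerivAt t hline).sub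
        (hasDerivAt_sum_pow_div_factorial_smul _ _ t)
    have hbound : ∀ t ∈ Set.Ico (0 : ℝ) 1,
        ‖(fderiv ℝ f (y + t • w) - ∑ j ∈ Finset.range (m + 1), (j.factorial : ℝ)⁻¹ •
          iteratedFDeriv ℝ j (fderiv ℝ f) y fun _ => t • w) w‖
        ≤ C * ‖w‖ ^ (((m + 1 : ℕ) : ℝ) + ε) := by
      intro t ht
      have hih := ih h.2.2 (hmem t ⟨ht.1, ht.2.le⟩)
      have htw : ‖t • w‖ ≤ ‖w‖ := by
        rw [norm_smul, Real.norm_of_nonneg ht.1]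
        exact mul_le_of_le_one_left (norm_nonneg _) ht.2.le
      rw [add_sub_cancel_left] at hih
      rw [Nat.cast_succ, add_right_comm, Real.rpow_add_one' (norm_nonneg _) (by positivity),
        ← mul_assoc]
      refine ContinuousLinearMap.le_of_opNorm_le _ (hih.trans ?_) w
      gcongr
    have hmean := norm_image_sub_le_of_norm_deriv_le_segment_01'
      (fun t ht => (hder t ht).hasDerivWithinAt) hbound
    simpa [Finset.sum_range_succ' _ (m + 1)] using hmean

theorem padTuple_zero {E : Type*} (j : ℕ) (v : Fin 0 → E) (h : E) :
    padTuple j v h = fun _ => h := by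
  ext1 i
  simp [padTuple]

theorem padTuple_succ {E : Type*} {k : ℕ} (j : ℕ) (v : Fin (k + 1) → E) (h : E) :
    padTuple (j + 1) v h = Fin.cons (v 0) (padTuple j (Fin.tail v) h) := by
  ext1 i
  cases i using Fin.cases <;> simp [padTuple, Fin.tail]

theorem sum_Icc_succ_succ {M : Type*} [AddCommMonoid M] (k n : ℕ) (g : ℕ → M) :
    ∑ j ∈ Finset.Icc (k + 1) (n + 1), g j = ∑ j ∈ Finset.Icc k n, g (j + 1) := by
  rw [← Finset.map_add_right_Icc, Finset.sum_map]
  rfl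

theorem HolderClass.exists_taylor_remainder (hε : 0 < ε) (hconv : Convex ℝ S) (hS : IsOpen S)
    (h : HolderClass ε C m f S) (hx : x ∈ S) (hy : y ∈ S) {k : ℕ} (hk : k ≤ m) :
    ∃ r : ContinuousMultilinearMap ℝ (fun _ : Fin k => E) F,
      (∀ v : Fin k → E, iteratedFDeriv ℝ k f x v =
        (∑ j ∈ Finset.Icc k m, ((j - k).factorial : ℝ)⁻¹ •
          iteratedFDeriv ℝ j f y (padTuple j v (x - y))) + r v) ∧
      ‖r‖ ≤ C * ‖x - y‖ ^ ((m : ℝ) + ε - (k : ℝ)) := by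
  induction k generalizing m F with
  | zero =>
    refine ⟨ContinuousMultilinearMap.uncurry0 ℝ E (f x - ∑ j ∈ Finset.range (m + 1),
      (j.factorial : ℝ)⁻¹ • iteratedFDeriv ℝ j f y (fun _ => x - y)), fun v => ?_, ?_⟩
    · rw [← Nat.range_succ_eq_Icc_zero]
      simp [padTuple_zero]
    · rw [ContinuousMultilinearMap.uncurry0_norm]
      simpa using h.norm_sub_taylor_le hε hconv hS hx hy
  | succ k ih =>
    obtain ⟨m, rfl⟩ := Nat.exists_eq_add_of_le' (Nat.one_le_of_lt hk)
    have hsmooth {j : ℕ} (hj : j ≤ m) : ContDiffOn ℝ ((j + 1 : ℕ) : WithTop ℕ∞) f S :=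
      (h.contDiffOn hε hS).of_le (by exact_mod_cast Nat.succ_le_succ hj)
    obtain ⟨r, hr, hr'⟩ := ih h.2.2 (Nat.le_of_succ_le_succ hk)
    refine ⟨r.flipLinear.uncurryLeft, fun v => ?_, ?_⟩
    · rw [iteratedFDeriv_succ_apply_tail hS (hsmooth (Nat.le_of_succ_le_succ hk)) hx, hr,
        sum_Icc_succ_succ]
      simp only [_root_.add_apply, _root_.sum_apply, _root_.smul_apply, Nat.add_sub_add_right]
      congr 1
      refine Finset.sum_congr rfl fun j hj => ?_
      rw [iteratedFDeriv_succ_apply_tail hS (hsmooth (Finset.mem_Icc.1 hj).2) hy, padTuple_succ]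
      simp
    · rw [ContinuousLinearMap.uncurryLeft_norm]
      have hflip : ‖r.flipLinear‖ ≤ ‖r‖ :=
        MultilinearMap.mkContinuousLinear_norm_le _ (norm_nonneg _) _
      refine (hflip.trans hr').trans_eq ?_
      push_cast
      ring_nf

theorem HolderClass.isLipWith (hε : 0 < ε) (hconv : Convex ℝ S) (hS : IsOpen S)
    (h : HolderClass ε C m f S) : IsLipWith m ε C f S := by
  refine ⟨ftaylorSeries ℝ f, fun x _ => rfl, fun k hk x hx σ v => ?_, fun k hk x hx => ?_, ?_⟩
  · exact iteratedFDeriv_comp_perm_of_contDiffOn hS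
      ((h.contDiffOn hε hS).of_le (by exact_mod_cast hk)) hx σ v
  · exact h.norm_iteratedFDeriv_le hk hx
  · choose! R hR using fun x (hx : x ∈ S) y (hy : y ∈ S) k (hk : k ≤ m) =>
      h.exists_taylor_remainder hε hconv hS hx hy hk
    exact ⟨R, fun k hk x hx y hy => hR x hx y hy k hk⟩

end Taylor

section LipschitzNorm

variable {E F : Type*} [NormedAddCommGroup E] [NormedSpace ℝ E] [NormedAddCommGroup F]
  [NormedSpace ℝ F] {f : E → F} {S S' : Set E} {x : E} {ε M M' : ℝ} {m : ℕ}

theorem IsLipWith.mono_set (hS : S' ⊆ S) (h : IsLipWith m ε M f S) : IsLipWith m ε M f S' := by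
  obtain ⟨J, hJ, hsymm, hbound, R, hR⟩ := h
  exact ⟨J, fun x hx => hJ x (hS hx), fun k hk x hx => hsymm k hk x (hS hx),
    fun k hk x hx => hbound k hk x (hS hx), R,
    fun k hk x hx y hy => hR k hk x (hS hx) y (hS hy)⟩

theorem IsLipWith.mono_const (hM : M ≤ M') (h : IsLipWith m ε M f S) : IsLipWith m ε M' f S := by
  obtain ⟨J, hJ, hsymm, hbound, R, hR⟩ := h
  exact ⟨J, hJ, hsymm, fun k hk x hx => (hbound k hk x hx).trans hM, R,
    fun k hk x hx y hy => ⟨(hR k hk x hx y hy).1, (hR k hk x hx y hy).2.trans (by gcongr)⟩⟩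

theorem IsLipWith.norm_le (h : IsLipWith m ε M f S) (hx : x ∈ S) : ‖f x‖ ≤ M := by
  obtain ⟨J, hJ, hJ'⟩ := h
  rw [← hJ x hx, (J x 0).curry0_norm]
  exact hJ'.bound 0 (Nat.zero_le _) x hx

theorem IsLipWith.lipNorm_le (hM : 0 ≤ M) (h : IsLipWith m ε M f S) : lipNorm m ε f S ≤ M :=
  csInf_le ⟨0, fun _ hK => hK.1⟩ ⟨hM, h⟩

theorem IsLip.nonempty_setOf_isLipWith (hx : x ∈ S) (h : IsLip m ε f S) :
    {M : ℝ | 0 ≤ M ∧ IsLipWith m ε M f S}.Nonempty :=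
  h.imp fun _ hK => ⟨(norm_nonneg _).trans (hK.norm_le hx), hK⟩

theorem IsLip.norm_le_lipNorm (hx : x ∈ S) (h : IsLip m ε f S) : ‖f x‖ ≤ lipNorm m ε f S :=
  le_csInf (h.nonempty_setOf_isLipWith hx) fun _ hK => hK.2.norm_le hx

theorem IsLip.isLipWith_of_lipNorm_lt (hx : x ∈ S) (h : IsLip m ε f S) (hM : lipNorm m ε f S < M) :
    IsLipWith m ε M f S :=
  let ⟨_, hK, hKM⟩ := exists_lt_of_csInf_lt (h.nonempty_setOf_isLipWith hx) hM
  hK.2.mono_const hKM.le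

end LipschitzNorm

section Jets

variable {E F : Type u} [NormedAddCommGroup E] [NormedSpace ℝ E] [NormedAddCommGroup F]
  [NormedSpace ℝ F] {S : Set E} {ε M : ℝ} {m : ℕ} {f : E → F}
  {J : E → FormalMultilinearSeries ℝ E F}

/-- The jet of the derivative of the zeroth term: `w` is inserted in the first slot of the terms
of `J`, whose orders all drop by one. -/
noncomputable def derivJet (J : FormalMultilinearSeries ℝ E F) :
    FormalMultilinearSeries ℝ E (E →L[ℝ] F) :=
  fun k => (J (k + 1)).curryLeft.flipMultilinear

theorem derivJet_apply (J : FormalMultilinearSeries ℝ E F) (k : ℕ) (v : Fin k → E) (w : E) :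
    derivJet J k v w = J (k + 1) (Fin.cons w v) := rfl

theorem derivJet_zero_apply (J : FormalMultilinearSeries ℝ E F) (w : E) :
    (derivJet J 0).curry0 w = J 1 fun _ => w := by
  refine congrArg (J 1) (funext fun i => ?_)
  rw [Fin.fin_one_eq_zero i]
  rfl

theorem norm_derivJet_le (J : FormalMultilinearSeries ℝ E F) (k : ℕ) :
    ‖derivJet J k‖ ≤ ‖J (k + 1)‖ := by
  refine ContinuousMultilinearMap.opNorm_le_bound (norm_nonneg _) fun v =>
    ContinuousLinearMap.opNorm_le_bound _ (by positivity) fun w => ?_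
  refine ((J (k + 1)).le_opNorm _).trans_eq ?_
  simp only [Fin.prod_univ_succ, Fin.cons_zero, Fin.cons_succ]
  ring

theorem IsLipJet.deriv (h : IsLipJet (m + 1) ε M J S) :
    IsLipJet m ε M (fun x => derivJet (J x)) S := by
  obtain ⟨hsymm, hbound, R, hR⟩ := h
  refine ⟨fun k hk x hx σ v => ?_, fun k hk x hx => ?_, fun x y => derivJet (R x y),
    fun k hk x hx y hy => ⟨fun v => ?_, ?_⟩⟩
  · ext w
    rw [derivJet_apply, derivJet_apply, ← hsymm (k + 1) (Nat.succ_le_succ hk) x hx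
      (Equiv.Perm.decomposeFin.symm (0, σ)) (Fin.cons w v)]
    congr 1
    ext1 i
    cases i using Fin.cases <;> simp
  · exact (norm_derivJet_le _ _).trans (hbound _ (Nat.succ_le_succ hk) x hx)
  · ext w
    rw [derivJet_apply, (hR (k + 1) (Nat.succ_le_succ hk) x hx y hy).1, sum_Icc_succ_succ]
    simp only [_root_.add_apply, _root_.sum_apply,
      _root_.smul_apply, derivJet_apply, padTuple_succ, Fin.tail_cons, Fin.cons_zero,
      Nat.add_sub_add_right]
  · refine (norm_derivJet_le _ _).trans
      ((hR (k + 1) (Nat.succ_le_succ hk) x hx y hy).2.trans_eq ?_)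
    push_cast
    ring_nf

theorem IsLipJet.exists_remainder (hf : ∀ x ∈ S, (J x 0).curry0 = f x) (h : IsLipJet m ε M J S) :
    ∃ r : E → E → F, ∀ x ∈ S, ∀ y ∈ S,
      f x = (∑ j ∈ Finset.range (m + 1), (j.factorial : ℝ)⁻¹ • J y j fun _ => x - y) + r x y ∧
        ‖r x y‖ ≤ M * ‖x - y‖ ^ ((m : ℝ) + ε) := by
  obtain ⟨R, hR⟩ := h.taylor
  refine ⟨fun x y => (R x y 0).curry0, fun x hx y hy => ?_⟩
  obtain ⟨htaylor, hbound⟩ := hR 0 (Nat.zero_le _) x hx y hy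
  rw [ContinuousMultilinearMap.curry0_norm]
  refine ⟨?_, by simpa using hbound⟩
  rw [← hf x hx]
  refine (htaylor 0).trans ?_
  rw [← Nat.range_succ_eq_Icc_zero]
  simp [padTuple_zero, ContinuousMultilinearMap.curry0]

theorem isLittleO_apply_const (T : ContinuousMultilinearMap ℝ (fun _ : Fin (m + 2) => E) F) :
    (fun w => T fun _ => w) =o[nhds 0] (id : E → E) := by
  refine Asymptotics.IsBigO.trans_isLittleO (.of_bound ‖T‖ (.of_forall fun w => ?_))
    (Asymptotics.isLittleO_norm_pow_id (Nat.lt_add_of_pos_left m.succ_pos))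
  simpa using T.le_opNorm fun _ => w

theorem isLittleO_of_norm_le_rpow {E F : Type*} [NormedAddCommGroup E] [NormedAddCommGroup F]
    {r : E → F} {s : ℝ} (hs : 1 < s)
    (h : ∀ᶠ w in nhds 0, ‖r w‖ ≤ M * ‖w‖ ^ s) : r =o[nhds 0] (id : E → E) := by
  have hlim : Filter.Tendsto (fun w : E => ‖w‖ ^ (s - 1)) (nhds 0) (nhds 0) := by
    have hcont : Continuous fun w : E => ‖w‖ ^ (s - 1) :=
      continuous_norm.rpow_const fun _ => Or.inr (sub_pos.2 hs).le
    simpa [Real.zero_rpow (sub_pos.2 hs).ne'] using hcont.tendsto 0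
  have hlittle : (fun w : E => ‖w‖ ^ (s - 1) * ‖w‖) =o[nhds 0] (id : E → E) := by
    have := ((Asymptotics.isLittleO_one_iff ℝ).2 hlim).mul_isBigO
      (Asymptotics.isBigO_refl (fun w : E => ‖w‖) (nhds 0))
    exact Asymptotics.IsLittleO.of_norm_right (by simpa only [one_mul, id_eq] using this)
  refine Asymptotics.IsBigO.trans_isLittleO (.of_bound M (h.mono fun w hw => hw.trans_eq ?_))
    hlittle
  rw [Real.norm_of_nonneg (by positivity), ← Real.rpow_add_one' (norm_nonneg _) (by linarith),
    sub_add_cancel]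

theorem IsLipJet.hasFDerivAt (hε : 0 < ε) (hS : IsOpen S)
    (hf : ∀ x ∈ S, (J x 0).curry0 = f x) (h : IsLipJet (m + 1) ε M J S) {x : E} (hx : x ∈ S) :
    HasFDerivAt f (derivJet (J x) 0).curry0 x := by
  obtain ⟨r, hr⟩ := h.exists_remainder hf
  have hmem : ∀ᶠ w in nhds (0 : E), x + w ∈ S :=
    ((continuous_const.add continuous_id).tendsto' 0 x (add_zero x)).eventually (hS.mem_nhds hx)
  have hexpand : (fun w => f (x + w) - f x - (derivJet (J x) 0).curry0 w) =ᶠ[nhds 0]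
      fun w => ∑ j ∈ Finset.range m, (((j + 2).factorial : ℝ)⁻¹ • J x (j + 2) fun _ => w)
        + r (x + w) x := by
    filter_upwards [hmem] with w hw
    have hzero : f x = J x 0 fun _ => w := (hf x hx).symm.trans
      (congrArg (J x 0) (Subsingleton.elim _ _))
    rw [(hr (x + w) hw x hx).1, derivJet_zero_apply, hzero, Finset.sum_range_succ',
      Finset.sum_range_succ']
    simp only [add_sub_cancel_left, zero_add, Nat.factorial_one, Nat.factorial_zero, Nat.cast_one,
      inv_one, one_smul]
    abel
  rw [hasFDerivAt_iff_isLittleO_nhds_zero]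
  refine Asymptotics.IsLittleO.congr' (.add (.fun_sum fun j _ =>
    (isLittleO_apply_const (J x (j + 2))).const_smul_left _) ?_) hexpand.symm .rfl
  refine isLittleO_of_norm_le_rpow (s := ((m + 1 : ℕ) : ℝ) + ε) (M := M) ?_ ?_
  · push_cast
    linarith [m.cast_nonneg (α := ℝ)]
  · filter_upwards [hmem] with w hw
    simpa using (hr (x + w) hw x hx).2

theorem IsLipJet.holderClass (hε : 0 < ε) (hS : IsOpen S)
    (hf : ∀ x ∈ S, (J x 0).curry0 = f x) (h : IsLipJet m ε M J S) : HolderClass ε M m f S := by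
  have hbound : ∀ x ∈ S, ‖f x‖ ≤ M := fun x hx => IsLipWith.norm_le ⟨J, hf, h⟩ hx
  induction m generalizing F with
  | zero =>
    obtain ⟨r, hr⟩ := h.exists_remainder hf
    refine ⟨hbound, fun x hx y hy => ?_⟩
    have hconst : (J y 0 fun _ => x - y) = f y :=
      (congrArg (J y 0) (Subsingleton.elim _ _)).trans (hf y hy)
    have hdiff : f x - f y = r x y := by
      simpa [hconst, sub_eq_iff_eq_add'] using (hr x hx y hy).1
    simpa [hdiff] using (hr x hx y hy).2
  | succ m ih =>
    have hderiv : ∀ x ∈ S, HasFDerivAt f (derivJet (J x) 0).curry0 x := fun x hx =>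
      h.hasFDerivAt hε hS hf hx
    have hjet : ∀ x ∈ S, (derivJet (J x) 0).curry0 = fderiv ℝ f x := fun x hx =>
      (hderiv x hx).fderiv.symm
    exact ⟨hbound, fun x hx => (hderiv x hx).differentiableAt.differentiableWithinAt,
      ih hjet h.deriv fun x hx => IsLipWith.norm_le ⟨_, hjet, h.deriv⟩ hx⟩

theorem IsLipWith.holderClass (hε : 0 < ε) (hS : IsOpen S) (h : IsLipWith m ε M f S) :
    HolderClass ε M m f S :=
  let ⟨_, hJ, hJ'⟩ := h
  hJ'.holderClass hε hS hJ

end Jets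

section Inverse

variable {E : Type u} [NormedAddCommGroup E] [NormedSpace ℝ E] {ε C₁ C₂ : ℝ} {m : ℕ}

/-- The constant of the derivative of a map `k` such that `fderiv ℝ k y` is the inverse, bounded by
`C₂`, of `A (k y)`, where `A` is of Hölder class `m` with constant `C₁`. -/
noncomputable def fderivInverseConst (ε C₂ : ℝ) : ℕ → ℝ → ℝ
  | 0, C₁ => compConst ε (ringInverseConst C₂ 0 C₁) 0 C₂
  | m + 1, C₁ => compConst ε (ringInverseConst C₂ (m + 1) C₁) (m + 1)
      (fderivInverseConst ε C₂ m (2 * C₁))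

theorem fderivInverseConst_nonneg (hC₁ : 0 ≤ C₁) (hC₂ : 0 ≤ C₂) (m : ℕ) :
    0 ≤ fderivInverseConst ε C₂ m C₁ := by
  induction m generalizing C₁ with
  | zero => exact compConst_nonneg (ringInverseConst_nonneg hC₁ hC₂ 0) hC₂ 0
  | succ m ih =>
    exact compConst_nonneg (ringInverseConst_nonneg hC₁ hC₂ _) (ih (by positivity)) _

theorem LipClass.of_fderiv_eq_ringInverse [CompleteSpace E] {S T : Set E} {A : E → E →L[ℝ] E}
    {k : E → E} (hε₀ : 0 < ε) (hε₁ : ε ≤ 1) (hC₁ : 0 ≤ C₁) (hC₂ : 0 ≤ C₂) (hS : IsOpen S)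
    (hSconv : Convex ℝ S) (hT : IsOpen T) (hTconv : Convex ℝ T) (hmaps : Set.MapsTo k T S)
    (hA : HolderClass ε C₁ m A S) (hunit : ∀ x ∈ S, IsUnit (A x))
    (hbound : ∀ x ∈ S, ‖Ring.inverse (A x)‖ ≤ C₂)
    (hk : ∀ y ∈ T, HasFDerivAt k (Ring.inverse (A (k y))) y) :
    LipClass ε (fderivInverseConst ε C₂ m C₁) (m + 1) k T := by
  refine ⟨fun y hy => (hk y hy).differentiableAt.differentiableWithinAt, ?_⟩
  have hinv := hA.ringInverse hε₀ hε₁ hC₁ hC₂ hS hSconv hunit hbound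
  have hconst := ringInverseConst_nonneg hC₁ hC₂ m
  induction m generalizing C₁ with
  | zero =>
    have hlip : LipClass ε C₂ 0 k T := fun x hx y hy =>
      hTconv.norm_image_sub_le_of_norm_hasFDerivWithin_le
        (fun z hz => (hk z hz).hasFDerivWithinAt) (fun z hz => hbound _ (hmaps hz)) hy hx
    exact (hinv.comp hε₀ hε₁ hconst hC₂ hT hTconv hS hlip hmaps).congr hT
      fun y hy => (hk y hy).fderiv
  | succ m ih =>
    have hA' := hA.of_succ hε₀ hε₁ hS hSconv
    have hlip : LipClass ε (fderivInverseConst ε C₂ m (2 * C₁)) (m + 1) k T :=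
      ⟨fun y hy => (hk y hy).differentiableAt.differentiableWithinAt,
        ih (by positivity) hA' (hA'.ringInverse hε₀ hε₁ (by positivity) hC₂ hS hSconv hunit hbound)
          (ringInverseConst_nonneg (by positivity) hC₂ m)⟩
    exact (hinv.comp hε₀ hε₁ hconst (fderivInverseConst_nonneg (by positivity) hC₂ m) hT hTconv hS
      hlip hmaps).congr hT fun y hy => (hk y hy).fderiv

section NormedRing

variable {R : Type*} [NormedRing R] [CompleteSpace R] {a : R}

theorem isUnit_of_norm_sub_one_le (ha : ‖a - 1‖ ≤ 1 / 2) : IsUnit a := by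
  have : ‖1 - a‖ < 1 := by
    rw [norm_sub_rev]
    linarith
  simpa using isUnit_one_sub_of_norm_lt_one this

theorem norm_ringInverse_le_two (hone : ‖(1 : R)‖ ≤ 1) (ha : ‖a - 1‖ ≤ 1 / 2) :
    ‖Ring.inverse a‖ ≤ 2 := by
  have hneumann : Ring.inverse a = 1 - (a - 1) * Ring.inverse a := by
    rw [sub_mul, Ring.mul_inverse_cancel _ (isUnit_of_norm_sub_one_le ha)]
    simp
  have hle : ‖Ring.inverse a‖ ≤ 1 + 1 / 2 * ‖Ring.inverse a‖ :=
    calc ‖Ring.inverse a‖ = ‖1 - (a - 1) * Ring.inverse a‖ := congrArg norm hneumann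
      _ ≤ 1 + 1 / 2 * ‖Ring.inverse a‖ :=
        norm_sub_le_of_le hone (norm_mul_le_of_le ha le_rfl)
  linarith

end NormedRing

theorem approximatesLinearOn_refl_of_norm_fderiv_sub_one_le {S : Set E} {h : E → E} {c : NNReal}
    (hconv : Convex ℝ S) (hd : ∀ x ∈ S, DifferentiableAt ℝ h x)
    (hclose : ∀ x ∈ S, ‖fderiv ℝ h x - 1‖ ≤ c) :
    ApproximatesLinearOn h (ContinuousLinearEquiv.refl ℝ E : E →L[ℝ] E) S c := fun _ hx _ hy => by
  simpa using hconv.norm_image_sub_le_of_norm_fderiv_le' hd hclose hy hx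

theorem exists_openPartialHomeomorph_of_approximatesLinearOn_refl [CompleteSpace E] {h : E → E}
    {x₀ : E} {α : ℝ} (hα : 0 < α) (hx₀ : h x₀ = 0)
    (hh : ApproximatesLinearOn h (ContinuousLinearEquiv.refl ℝ E : E →L[ℝ] E)
      (Metric.ball x₀ α) (1 / 4)) :
    ∃ P : OpenPartialHomeomorph E E, ⇑P = h ∧ P.source = Metric.ball x₀ α ∧
      Metric.ball 0 (2 * α / 3) ⊆ P.target := by
  have hnorm [Nontrivial E] : ‖((ContinuousLinearEquiv.refl ℝ E).symm : E →L[ℝ] E)‖₊ = 1 := by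
    ext
    simp
  have hsmall : Subsingleton E ∨
      (1 / 4 : NNReal) < ‖((ContinuousLinearEquiv.refl ℝ E).symm : E →L[ℝ] E)‖₊⁻¹ := by
    rcases subsingleton_or_nontrivial E with hE | hE
    · exact .inl hE
    · right
      rw [hnorm, inv_one, ← NNReal.coe_lt_coe]
      norm_num
  refine ⟨hh.toOpenPartialHomeomorph h _ hsmall Metric.isOpen_ball, rfl, rfl, ?_⟩
  rcases subsingleton_or_nontrivial E with hE | hE
  · intro y _
    rw [Subsingleton.elim y (h x₀)]
    exact (hh.toOpenPartialHomeomorph h _ hsmall Metric.isOpen_ball).map_source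
      (Metric.mem_ball_self hα)
  · have hsurj := hh.closedBall_subset_target hsmall Metric.isOpen_ball (b := x₀) (ε := 8 * α / 9)
      (by positivity) (Metric.closedBall_subset_ball (by linarith))
    rw [hnorm, hx₀] at hsurj
    refine (Metric.ball_subset_closedBall.trans (Metric.closedBall_subset_closedBall ?_)).trans
      hsurj
    push_cast
    linarith

theorem hasFDerivAt_symm_ringInverse [CompleteSpace E] (P : OpenPartialHomeomorph E E) {y : E}
    (hy : y ∈ P.target) (hP : DifferentiableAt ℝ P (P.symm y))
    (hunit : IsUnit (fderiv ℝ P (P.symm y))) :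
    HasFDerivAt P.symm (Ring.inverse (fderiv ℝ P (P.symm y))) y := by
  obtain ⟨a, ha⟩ := hunit
  have hderiv : HasFDerivAt P ((ContinuousLinearEquiv.unitsEquiv ℝ E a : E ≃L[ℝ] E) : E →L[ℝ] E)
      (P.symm y) := by
    have hcoe : ((ContinuousLinearEquiv.unitsEquiv ℝ E a : E ≃L[ℝ] E) : E →L[ℝ] E)
        = fderiv ℝ P (P.symm y) := ha ▸ rfl
    exact hcoe ▸ hP.hasFDerivAt
  rw [← ha, Ring.inverse_unit]
  exact P.hasFDerivAt_symm hy hderiv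

/-- `k` inverts `h` between the ball of radius `α` around the zero `x₀` of `h` and the ball of
radius `2 α / 3` around `0`, and is of Lipschitz class there. The sizes are those one gets when
`fderiv ℝ h` stays within `1 / 4` of the identity. -/
structure IsBallInverse (ε K : ℝ) (m : ℕ) (h k : E → E) (x₀ : E) (α : ℝ) : Prop where
  norm_apply_le : ∀ x ∈ Metric.ball x₀ α, ‖h x‖ ≤ 5 / 4 * ‖x - x₀‖
  mapsTo : Set.MapsTo k (Metric.ball 0 (2 * α / 3)) (Metric.ball x₀ α)
  right_inv : ∀ y ∈ Metric.ball (0 : E) (2 * α / 3), h (k y) = y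
  left_inv : ∀ x ∈ Metric.ball x₀ α, k (h x) = x
  lipClass : LipClass ε K m k (Metric.ball 0 (2 * α / 3))

theorem exists_isBallInverse [CompleteSpace E] (hε₀ : 0 < ε) (hε₁ : ε ≤ 1) (hC₁ : 0 ≤ C₁) {x₀ : E}
    {α : ℝ} {h : E → E} (hα : 0 < α) (hx₀ : h x₀ = 0)
    (hh : LipClass ε C₁ (m + 1) h (Metric.ball x₀ α))
    (hclose : ∀ x ∈ Metric.ball x₀ α, ‖fderiv ℝ h x - 1‖ ≤ 1 / 4) :
    ∃ k, IsBallInverse ε (fderivInverseConst ε 2 m C₁) (m + 1) h k x₀ α := by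
  have hd : ∀ x ∈ Metric.ball x₀ α, DifferentiableAt ℝ h x := fun x =>
    hh.differentiableAt Metric.isOpen_ball
  have hclose' : ∀ x ∈ Metric.ball x₀ α, ‖fderiv ℝ h x - 1‖ ≤ 1 / 2 := fun x hx =>
    (hclose x hx).trans (by norm_num)
  have happrox := approximatesLinearOn_refl_of_norm_fderiv_sub_one_le (c := 1 / 4)
    (convex_ball x₀ α) hd (by simpa using hclose)
  obtain ⟨P, rfl, hsource, htarget⟩ :=
    exists_openPartialHomeomorph_of_approximatesLinearOn_refl hα hx₀ happrox
  have hmaps : Set.MapsTo P.symm (Metric.ball 0 (2 * α / 3)) (Metric.ball x₀ α) := fun y hy =>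
    hsource ▸ P.map_target (htarget hy)
  refine ⟨P.symm, fun x hx => ?_, hmaps, fun y hy => P.right_inv (htarget hy),
    fun x hx => P.left_inv (hsource ▸ hx), ?_⟩
  · have hlin : ‖P x - (x - x₀)‖ ≤ 1 / 4 * ‖x - x₀‖ := by
      simpa [hx₀] using happrox x hx x₀ (Metric.mem_ball_self hα)
    linarith [norm_sub_norm_le (P x) (x - x₀)]
  · have hunit : ∀ x ∈ Metric.ball x₀ α, IsUnit (fderiv ℝ P x) := fun x hx =>
      isUnit_of_norm_sub_one_le (hclose' x hx)
    exact .of_fderiv_eq_ringInverse hε₀ hε₁ hC₁ zero_le_two Metric.isOpen_ball (convex_ball _ _)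
      Metric.isOpen_ball (convex_ball _ _) hmaps hh.2 hunit
      (fun x hx => norm_ringInverse_le_two ContinuousLinearMap.norm_id_le (hclose' x hx))
      fun y hy => hasFDerivAt_symm_ringInverse P (htarget hy) (hd _ (hmaps hy))
        (hunit _ (hmaps hy))

end Inverse

/-- A choice of leading coordinates of `E`, with values in `G`: after the change of coordinates
`coord` they are the component `proj`, whose embedding is `incl`, and all these maps are
contractions. On `ℝ^p` with the sup norm, `coord` permutes the coordinates so as to bring `k`
chosen ones to the front. -/
structure LeadingCoords (E G : Type*) [NormedAddCommGroup E] [NormedSpace ℝ E]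
    [NormedAddCommGroup G] [NormedSpace ℝ G] where
  coord : E ≃L[ℝ] E
  proj : E →L[ℝ] G
  incl : G →L[ℝ] E
  proj_incl : ∀ v, proj (incl v) = v
  norm_coord_le : ‖(coord : E →L[ℝ] E)‖ ≤ 1
  norm_coord_symm_le : ‖(coord.symm : E →L[ℝ] E)‖ ≤ 1
  norm_proj_le : ‖proj‖ ≤ 1
  norm_incl_le : ‖incl‖ ≤ 1

namespace LeadingCoords

variable {E G : Type*} [NormedAddCommGroup E] [NormedSpace ℝ E] [NormedAddCommGroup G]
  [NormedSpace ℝ G] (s : LeadingCoords E G)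

/-- The leading coordinates of a vector. -/
def lead : E →L[ℝ] G := s.proj ∘L (s.coord : E →L[ℝ] E)

/-- The vector with given leading coordinates whose other coordinates vanish. -/
def leadIncl : G →L[ℝ] E := (s.coord.symm : E →L[ℝ] E) ∘L s.incl

/-- The projection killing the leading component, to be applied after `coord`. -/
def compl : E →L[ℝ] E := ContinuousLinearMap.id ℝ E - s.incl ∘L s.proj

theorem lead_apply (x : E) : s.lead x = s.proj (s.coord x) := rfl

theorem leadIncl_apply (v : G) : s.leadIncl v = s.coord.symm (s.incl v) := rfl

theorem compl_apply (y : E) : s.compl y = y - s.incl (s.proj y) := rfl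

theorem proj_surjective : Function.Surjective s.proj := fun v => ⟨s.incl v, s.proj_incl v⟩

theorem isOpenMap_proj : IsOpenMap s.proj :=
  IsOpenMap.of_sections fun x => ⟨fun v => x + s.incl (v - s.proj x), by fun_prop, by simp,
    fun v => by simp [s.proj_incl]⟩

theorem norm_lead_le : ‖s.lead‖ ≤ 1 :=
  (s.proj.opNorm_comp_le _).trans (mul_le_one₀ s.norm_proj_le (norm_nonneg _) s.norm_coord_le)

theorem norm_leadIncl_le : ‖s.leadIncl‖ ≤ 1 :=
  (ContinuousLinearMap.opNorm_comp_le _ _).trans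
    (mul_le_one₀ s.norm_coord_symm_le (norm_nonneg _) s.norm_incl_le)

theorem norm_compl_apply_le (y : E) : ‖s.compl y‖ ≤ 2 * ‖y‖ := by
  have hincl : ‖s.incl (s.proj y)‖ ≤ 1 * (1 * ‖y‖) :=
    s.incl.le_of_opNorm_le_of_le s.norm_incl_le (s.proj.le_of_opNorm_le s.norm_proj_le y)
  exact (norm_sub_le_of_le (le_refl ‖y‖) hincl).trans_eq (by ring)

/-- The linear map which replaces the leading coordinates by `B`. -/
def replaceLead (B : E →L[ℝ] G) : E →L[ℝ] E := s.incl ∘L B + s.compl ∘L (s.coord : E →L[ℝ] E)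

theorem replaceLead_apply (B : E →L[ℝ] G) (x : E) :
    s.replaceLead B x = s.incl (B x) + s.compl (s.coord x) := rfl

theorem replaceLead_sub_replaceLead (B B' : E →L[ℝ] G) :
    s.replaceLead B - s.replaceLead B' = s.incl ∘L (B - B') := by
  rw [replaceLead, replaceLead, add_sub_add_right_eq_sub, ContinuousLinearMap.comp_sub]

/-- The inverse of `replaceLead`, for an inverse `N` of the minor of `B` in the leading
coordinates. -/
def replaceLeadInv (B : E →L[ℝ] G) (N : G →L[ℝ] G) : E →L[ℝ] E :=
  (s.coord.symm : E →L[ℝ] E) ∘L s.compl +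
    s.leadIncl ∘L N ∘L (s.proj - B ∘L (s.coord.symm : E →L[ℝ] E) ∘L s.compl)

theorem replaceLeadInv_apply (B : E →L[ℝ] G) (N : G →L[ℝ] G) (y : E) :
    s.replaceLeadInv B N y = s.coord.symm (s.compl y) +
      s.leadIncl (N (s.proj y - B (s.coord.symm (s.compl y)))) := rfl

variable {s} {B : E →L[ℝ] G} {M₁ M₂ : ℝ}

theorem norm_replaceLeadInv_le {N : G →L[ℝ] G} (hM₁ : 0 ≤ M₁) (hM₂ : 0 ≤ M₂) (hB : ‖B‖ ≤ M₁)
    (hN : ‖N‖ ≤ M₂) : ‖s.replaceLeadInv B N‖ ≤ 2 + M₂ * (1 + M₁ * 2) := by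
  refine ContinuousLinearMap.opNorm_le_bound _ (by positivity) fun y => ?_
  have hrest : ‖s.coord.symm (s.compl y)‖ ≤ 1 * (2 * ‖y‖) :=
    (s.coord.symm : E →L[ℝ] E).le_of_opNorm_le_of_le s.norm_coord_symm_le
      (s.norm_compl_apply_le y)
  have hlead : ‖s.proj y - B (s.coord.symm (s.compl y))‖ ≤ 1 * ‖y‖ + M₁ * (1 * (2 * ‖y‖)) :=
    norm_sub_le_of_le (s.proj.le_of_opNorm_le s.norm_proj_le y) (B.le_of_opNorm_le_of_le hB hrest)
  exact (norm_add_le_of_le hrest (s.leadIncl.le_of_opNorm_le_of_le s.norm_leadIncl_le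
    (N.le_of_opNorm_le_of_le hN hlead))).trans_eq (by ring)

theorem exists_equiv_replaceLead (A : G ≃L[ℝ] G) (hA : ∀ v, B (s.leadIncl v) = A v) (hM₁ : 0 ≤ M₁)
    (hM₂ : 0 ≤ M₂) (hB : ‖B‖ ≤ M₁) (hA' : ‖(A.symm : G →L[ℝ] G)‖ ≤ M₂) :
    ∃ L : E ≃L[ℝ] E, (L : E →L[ℝ] E) = s.replaceLead B ∧
      ‖(L.symm : E →L[ℝ] E)‖ ≤ 2 + M₂ * (1 + M₁ * 2) := by
  refine ⟨.equivOfInverse (s.replaceLead B) (s.replaceLeadInv B A.symm) (fun x => ?_)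
    (fun y => ?_), rfl, norm_replaceLeadInv_le hM₁ hM₂ hB hA'⟩
  · have hminor : A.symm (B (s.coord.symm (s.incl (s.proj (s.coord x))))) = s.proj (s.coord x) :=
      A.symm_apply_eq.2 (hA _)
    simp [replaceLead_apply, replaceLeadInv_apply, leadIncl_apply, compl_apply, s.proj_incl,
      hminor]
  · have hminor (v : G) : B (s.coord.symm (s.incl (A.symm v))) = v :=
      (hA _).trans (A.apply_symm_apply v)
    simp [replaceLead_apply, replaceLeadInv_apply, leadIncl_apply, compl_apply, s.proj_incl,
      hminor]

end LeadingCoords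

section Straightening

variable {E G : Type u} [NormedAddCommGroup E] [NormedSpace ℝ E] [NormedAddCommGroup G]
  [NormedSpace ℝ G] {s : LeadingCoords E G} {u : E → G} {x₀ x : E} {ε M₁ M₂ α : ℝ} {m : ℕ}

/-- The map which replaces the leading coordinates of `x - x₀` by `u x - u x₀`. -/
def straighten (s : LeadingCoords E G) (u : E → G) (x₀ x : E) : E :=
  s.incl (u x - u x₀) + s.compl (s.coord (x - x₀))

theorem proj_straighten (s : LeadingCoords E G) (u : E → G) (x₀ x : E) :
    s.proj (straighten s u x₀ x) = u x - u x₀ := by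
  simp [straighten, s.compl_apply, s.proj_incl]

theorem straighten_self (s : LeadingCoords E G) (u : E → G) (x₀ : E) :
    straighten s u x₀ x₀ = 0 := by
  simp [straighten]

theorem hasFDerivAt_straighten (s : LeadingCoords E G) (x₀ : E) (hu : DifferentiableAt ℝ u x) :
    HasFDerivAt (straighten s u x₀) (s.replaceLead (fderiv ℝ u x)) x :=
  (s.incl.hasFDerivAt.comp x (hu.hasFDerivAt.sub_const _)).add
    ((s.compl ∘L (s.coord : E →L[ℝ] E)).hasFDerivAt.comp x ((hasFDerivAt_id x).sub_const x₀))

theorem lipClass_straighten {S : Set E} (hS : IsOpen S) (hu : LipClass ε M₁ (m + 1) u S) :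
    LipClass ε (M₁ + 2) (m + 1) (straighten s u x₀) S := by
  have hd : ∀ x ∈ S, HasFDerivAt (straighten s u x₀) (s.replaceLead (fderiv ℝ u x)) x :=
    fun x hx => hasFDerivAt_straighten s x₀ (hu.differentiableAt hS hx)
  have hincl := hu.2.clm_comp hS (ContinuousLinearMap.compL ℝ E G E s.incl)
    ((norm_compL_apply_le s.incl).trans s.norm_incl_le)
  have hcompl : ‖s.compl ∘L (s.coord : E →L[ℝ] E)‖ ≤ 2 :=
    ContinuousLinearMap.opNorm_le_bound _ zero_le_two fun x =>
      (s.norm_compl_apply_le _).trans (mul_le_mul_of_nonneg_left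
        (((s.coord : E →L[ℝ] E).le_of_opNorm_le s.norm_coord_le x).trans_eq (one_mul _))
        zero_le_two)
  refine ⟨fun x hx => (hd x hx).differentiableAt.differentiableWithinAt, ?_⟩
  rw [← one_mul M₁]
  exact (hincl.add hS (.const zero_le_two hcompl)).congr hS fun x hx => (hd x hx).fderiv

/-- The bound on the inverse of the derivative of the straightening map at the base point, for a
map with derivative bounded by `M₁` and a minor with inverse bounded by `M₂`. -/
def straightenConst (M₁ M₂ : ℝ) : ℝ := 2 + M₂ * (1 + M₁ * 2)

theorem straightenConst_pos (hM₁ : 0 ≤ M₁) (hM₂ : 0 ≤ M₂) : 0 < straightenConst M₁ M₂ := by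
  unfold straightenConst
  positivity

/-- A radius on which the derivative of `u` varies so little that the straightening map is close
to its linearisation at the base point. -/
noncomputable def straightenRadius (ε M₁ M₂ : ℝ) (m : ℕ) : ℝ :=
  (1 / (4 * (straightenConst M₁ M₂ * (2 ^ m * M₁ + 1)))) ^ (1 / ε)

theorem straightenRadius_pos (hM₁ : 0 ≤ M₁) (hM₂ : 0 ≤ M₂) : 0 < straightenRadius ε M₁ M₂ m := by
  have := straightenConst_pos hM₁ hM₂
  unfold straightenRadius
  positivity

theorem straightenConst_mul_rpow_le {r : ℝ} (hε₀ : 0 < ε) (hM₁ : 0 ≤ M₁) (hM₂ : 0 ≤ M₂)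
    (hr₀ : 0 ≤ r) (hr : r ≤ straightenRadius ε M₁ M₂ m) :
    straightenConst M₁ M₂ * (2 ^ m * M₁ * r ^ ε) ≤ 1 / 4 := by
  have hΛ := straightenConst_pos hM₁ hM₂
  have hpow : r ^ ε ≤ 1 / (4 * (straightenConst M₁ M₂ * (2 ^ m * M₁ + 1))) := by
    refine (Real.rpow_le_rpow hr₀ hr hε₀.le).trans_eq ?_
    rw [straightenRadius, ← Real.rpow_mul (by positivity), one_div_mul_cancel hε₀.ne',
      Real.rpow_one]
  rw [le_div_iff₀ (by positivity)] at hpow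
  have hnonneg : 0 ≤ straightenConst M₁ M₂ * r ^ ε := by positivity
  linarith

theorem norm_symm_comp_replaceLead_sub_one_le {Λ r : ℝ} {L : E ≃L[ℝ] E} {B B' : E →L[ℝ] G}
    (hL : (L : E →L[ℝ] E) = s.replaceLead B) (hL' : ‖(L.symm : E →L[ℝ] E)‖ ≤ Λ)
    (hB : ‖B' - B‖ ≤ r) : ‖(L.symm : E →L[ℝ] E) ∘L s.replaceLead B' - 1‖ ≤ Λ * r := by
  have hone : (1 : E →L[ℝ] E) = (L.symm : E →L[ℝ] E) ∘L s.replaceLead B := by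
    rw [← hL]
    exact L.coe_symm_comp_coe.symm
  have hincl : ‖s.incl ∘L (B' - B)‖ ≤ r :=
    (s.incl.opNorm_comp_le _).trans
      ((mul_le_mul s.norm_incl_le hB (norm_nonneg _) zero_le_one).trans_eq (one_mul r))
  rw [hone, ← ContinuousLinearMap.comp_sub, s.replaceLead_sub_replaceLead]
  exact (ContinuousLinearMap.opNorm_comp_le _ _).trans
    (mul_le_mul hL' hincl (norm_nonneg _) ((norm_nonneg _).trans hL'))

/-- `L` normalises the straightening map of `u` at `x₀`, and `k` inverts the normalised map; the
constants are those of a map `u` of Lipschitz class with constant `M₁` and a minor with inverse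
bounded by `M₂`. -/
structure IsStraightening (ε M₁ M₂ : ℝ) (m : ℕ) (s : LeadingCoords E G) (u : E → G) (x₀ : E)
    (α : ℝ) (L : E ≃L[ℝ] E) (k : E → E) : Prop where
  norm_symm_le : ‖(L.symm : E →L[ℝ] E)‖ ≤ straightenConst M₁ M₂
  lipClass : LipClass ε (M₁ + 2) (m + 1) (straighten s u x₀) (Metric.ball x₀ α)
  isBallInverse : IsBallInverse ε (fderivInverseConst ε 2 m (straightenConst M₁ M₂ * (M₁ + 2)))
    (m + 1) (fun x => L.symm (straighten s u x₀ x)) k x₀ α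

theorem exists_isStraightening [CompleteSpace E] (hε₀ : 0 < ε) (hε₁ : ε ≤ 1) (hM₁ : 0 ≤ M₁)
    (hM₂ : 0 ≤ M₂) (hα₀ : 0 < α) (hα : α ≤ straightenRadius ε M₁ M₂ m)
    (hu : LipClass ε M₁ (m + 1) u (Metric.ball x₀ α)) (A : G ≃L[ℝ] G)
    (hA : ∀ v, fderiv ℝ u x₀ (s.leadIncl v) = A v) (hA' : ‖(A.symm : G →L[ℝ] G)‖ ≤ M₂) :
    ∃ L k, IsStraightening ε M₁ M₂ m s u x₀ α L k := by
  have hx₀ : x₀ ∈ Metric.ball x₀ α := Metric.mem_ball_self hα₀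
  obtain ⟨L, hL, hL'⟩ := s.exists_equiv_replaceLead A hA hM₁ hM₂ (hu.2.norm_le x₀ hx₀) hA'
  have hf : LipClass ε (M₁ + 2) (m + 1) (straighten s u x₀) (Metric.ball x₀ α) :=
    lipClass_straighten Metric.isOpen_ball hu
  refine ⟨L, (exists_isBallInverse hε₀ hε₁
    (mul_nonneg (straightenConst_pos hM₁ hM₂).le (by positivity)) hα₀ ?_
    (hf.clm_comp Metric.isOpen_ball (L.symm : E →L[ℝ] E) hL') fun x hx => ?_).imp
      fun k hk => ⟨hL', hf, hk⟩⟩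
  · simp [straighten_self]
  · have hderiv := (L.symm : E →L[ℝ] E).hasFDerivAt.comp x
      (hasFDerivAt_straighten s x₀ (hu.differentiableAt Metric.isOpen_ball hx))
    have hvar := (hu.2.zero hε₀ hε₁ Metric.isOpen_ball (convex_ball _ _)).2 x hx x₀ hx₀
    rw [show fderiv ℝ (fun x => (L.symm : E →L[ℝ] E) (straighten s u x₀ x)) x = _ from
      hderiv.fderiv]
    exact (norm_symm_comp_replaceLead_sub_one_le hL hL' hvar).trans
      (straightenConst_mul_rpow_le hε₀ hM₁ hM₂ (norm_nonneg _)
        ((mem_ball_iff_norm.1 hx).le.trans hα))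

end Straightening

section ConstantRank

variable {E F G : Type*} [NormedAddCommGroup E] [NormedSpace ℝ E] [NormedAddCommGroup F]
  [NormedSpace ℝ F] [NormedAddCommGroup G] [NormedSpace ℝ G]

theorem apply_eq_zero_of_finrank_range_le {K E F G : Type*} [DivisionRing K] [AddCommGroup E]
    [Module K E] [AddCommGroup F] [Module K F] [AddCommGroup G] [Module K G]
    [FiniteDimensional K F] (D : E →ₗ[K] F) (Q : F →ₗ[K] G) (hsurj : Function.Surjective (Q ∘ₗ D))
    (hrank : Module.finrank K (LinearMap.range D) ≤ Module.finrank K G) {v : E}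
    (hv : Q (D v) = 0) : D v = 0 := by
  let Q' : LinearMap.range D →ₗ[K] G := Q.domRestrict (LinearMap.range D)
  have hQ' : Function.Surjective Q' := fun w => by
    obtain ⟨x, hx⟩ := hsurj w
    exact ⟨⟨D x, x, rfl⟩, hx⟩
  have : FiniteDimensional K G := Module.Finite.of_surjective Q' hQ'
  have hinj : Function.Injective Q' :=
    (LinearMap.injective_iff_surjective_of_finrank_eq_finrank
      (hrank.antisymm (LinearMap.finrank_le_finrank_of_surjective hQ'))).2 hQ'
  exact congrArg Subtype.val ((map_eq_zero_iff Q' hinj (x := ⟨D v, v, rfl⟩)).1 hv)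

theorem fderiv_apply_eq_zero_of_comp_eventuallyEq [FiniteDimensional ℝ F] {Φ : E → F} {y v : E}
    (hΦ : DifferentiableAt ℝ Φ y)
    (hrank : Module.finrank ℝ (LinearMap.range (fderiv ℝ Φ y).toLinearMap) ≤ Module.finrank ℝ G)
    {π : E →L[ℝ] G} (hπ : Function.Surjective π) {Q : F →L[ℝ] G} {c : G}
    (hQ : (fun z => Q (Φ z)) =ᶠ[nhds y] fun z => c + π z) (hv : π v = 0) :
    fderiv ℝ Φ y v = 0 := by
  have hcomp : Q ∘L fderiv ℝ Φ y = π :=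
    (Q.hasFDerivAt.comp y hΦ.hasFDerivAt).unique
      ((π.hasFDerivAt.const_add c).congr_of_eventuallyEq hQ)
  have hcomp' (w : E) : Q (fderiv ℝ Φ y w) = π w := DFunLike.congr_fun hcomp w
  exact apply_eq_zero_of_finrank_range_le (fderiv ℝ Φ y).toLinearMap Q.toLinearMap
    (fun w => (hπ w).imp fun x hx => (hcomp' x).trans hx) hrank ((hcomp' v).trans hv)

theorem eq_of_fderiv_apply_sub_eq_zero {H : Set E} (hconv : Convex ℝ H) {Φ : E → F}
    (hΦ : ∀ x ∈ H, DifferentiableAt ℝ Φ x) {y z : E} (hy : y ∈ H) (hz : z ∈ H)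
    (hzero : ∀ x ∈ H, fderiv ℝ Φ x (z - y) = 0) : Φ y = Φ z := by
  have hderiv : ∀ t ∈ Set.Icc (0 : ℝ) 1,
      HasDerivWithinAt (fun t : ℝ => Φ (y + t • (z - y))) 0 (Set.Icc 0 1) t := fun t ht => by
    have hmem := hconv.add_smul_sub_mem hy hz ht
    have hline : HasDerivAt (fun t : ℝ => y + t • (z - y)) (z - y) t := by
      simpa using ((hasDerivAt_id t).smul_const (z - y)).const_add y
    rw [← hzero _ hmem]
    exact ((hΦ _ hmem).hasFDerivAt.comp_hasDerivAt t hline).hasDerivWithinAt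
  have hnorm := norm_image_sub_le_of_norm_deriv_le_segment_01' hderiv (C := 0) (by simp)
  simp only [one_smul, zero_smul, add_zero, add_sub_cancel, norm_le_zero_iff] at hnorm
  exact (sub_eq_zero.1 hnorm).symm

theorem eq_of_proj_eq_of_finrank_range_le [FiniteDimensional ℝ F] {H : Set E} (hH : IsOpen H)
    (hconv : Convex ℝ H) {Φ : E → F} (hΦ : ∀ x ∈ H, DifferentiableAt ℝ Φ x)
    (hrank : ∀ x ∈ H, Module.finrank ℝ (LinearMap.range (fderiv ℝ Φ x).toLinearMap)
      ≤ Module.finrank ℝ G) {π : E →L[ℝ] G} (hπ : Function.Surjective π) {Q : F →L[ℝ] G} {c : G}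
    (hQ : ∀ x ∈ H, Q (Φ x) = c + π x) {y z : E} (hy : y ∈ H) (hz : z ∈ H) (hyz : π y = π z) :
    Φ y = Φ z :=
  eq_of_fderiv_apply_sub_eq_zero hconv hΦ hy hz fun x hx =>
    fderiv_apply_eq_zero_of_comp_eventuallyEq (hΦ x hx) (hrank x hx) hπ
      (Filter.eventuallyEq_of_mem (hH.mem_nhds hx) hQ) (by rw [map_sub, hyz, sub_self])

end ConstantRank

section Descent

variable {E F G : Type u} [NormedAddCommGroup E] [NormedSpace ℝ E] [NormedAddCommGroup F]
  [NormedSpace ℝ F] [NormedAddCommGroup G] [NormedSpace ℝ G] {ε C : ℝ} {m : ℕ}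

theorem exists_holderClass_factor (hε₀ : 0 < ε) (hε₁ : ε ≤ 1) (hC : 0 ≤ C) {H H' : Set E}
    (hH' : IsOpen H') {Φ : E → F} (hΦ : HolderClass ε C (m + 1) Φ H') {π : E →L[ℝ] G}
    {e : G →L[ℝ] E} (hπe : ∀ v, π (e v) = v)
    (heq : ∀ y ∈ H', ∀ z ∈ H', π y = π z → Φ y = Φ z) {ρ : ℝ} (hρ : 0 < ρ)
    (hHH' : ∀ y ∈ H, ∀ d, ‖d‖ < ρ → y + e d ∈ H') :
    ∃ Ψ : G → F, (∀ y ∈ H', Ψ (π y) = Φ y) ∧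
      ∃ C', 0 ≤ C' ∧ HolderClass ε C' (m + 1) Ψ (π '' H) := by
  let Ψ (v : G) : F := Φ (Function.invFunOn π H' v)
  have hΨ : ∀ y ∈ H', Ψ (π y) = Φ y := fun y hy =>
    heq _ (Function.invFunOn_mem ⟨y, hy, rfl⟩) _ hy (Function.invFunOn_eq ⟨y, hy, rfl⟩)
  have hK := compConst_nonneg (ε := ε) hC (norm_nonneg e) (m + 1)
  refine ⟨Ψ, hΨ, _, by positivity, HolderClass.of_forall_ball hε₀ hρ hK ?_⟩
  rintro _ ⟨y, hy, rfl⟩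
  have hmaps : Set.MapsTo (fun v => e v + (y - e (π y))) (Metric.ball (π y) ρ) H' := fun v hv => by
    have hshift : e v + (y - e (π y)) = y + e (v - π y) := by
      rw [map_sub]
      abel
    exact Set.mem_of_eq_of_mem hshift (hHH' y hy _ (mem_ball_iff_norm.1 hv))
  refine (hΦ.comp hε₀ hε₁ hC (norm_nonneg e) Metric.isOpen_ball (convex_ball _ _) hH'
    (.affine (norm_nonneg e) e le_rfl _) hmaps).congr Metric.isOpen_ball fun v hv => ?_
  rw [← hΨ _ (hmaps hv)]
  simp [hπe]

end Descent

section Flatten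

variable {F G : Type u} [NormedAddCommGroup F] [NormedSpace ℝ F] [NormedAddCommGroup G]
  [NormedSpace ℝ G] {t : LeadingCoords F G} {Ψ : G → F} {c : G} {H : Set G} {ε C : ℝ} {m : ℕ}

/-- The shear of the target space which maps `Ψ v` to `t.incl v` when the leading coordinates of
`Ψ v` are `c + v`. -/
def flatten (t : LeadingCoords F G) (Ψ : G → F) (c : G) (w : F) : F :=
  t.coord (w - Ψ (t.lead w - c)) + t.incl (t.lead w - c)

/-- The inverse of `flatten`. -/
def unflatten (t : LeadingCoords F G) (Ψ : G → F) (z : F) : F :=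
  t.coord.symm (t.compl z) + Ψ (t.proj z)

/-- The set on which `flatten` makes sense for a map `Ψ` defined on `H`. -/
def flattenSource (t : LeadingCoords F G) (c : G) (H : Set G) : Set F :=
  (fun w => t.lead w - c) ⁻¹' H

theorem contDiff_lead_sub_const (t : LeadingCoords F G) (c : G) {n : WithTop ℕ∞} :
    ContDiff ℝ n fun w => t.lead w - c :=
  t.lead.contDiff.sub contDiff_const

theorem isOpen_flattenSource (hH : IsOpen H) : IsOpen (flattenSource t c H) :=
  hH.preimage (contDiff_lead_sub_const t c (n := 0)).continuous

theorem convex_flattenSource (hH : Convex ℝ H) : Convex ℝ (flattenSource t c H) :=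
  hH.affine_preimage (t.lead.toLinearMap.toAffineMap - AffineMap.const ℝ F c)

theorem flatten_eq_incl {v : G} {w : F} (hw : t.lead w = c + v) (hΨ : Ψ v = w) :
    flatten t Ψ c w = t.incl v := by
  simp [flatten, hw, hΨ]

theorem proj_flatten (hΨ : ∀ v ∈ H, t.lead (Ψ v) = c + v) {w : F}
    (hw : w ∈ flattenSource t c H) : t.proj (flatten t Ψ c w) = t.lead w - c := by
  rw [flatten, map_add, t.proj_incl, ← t.lead_apply, map_sub, hΨ (t.lead w - c) hw]
  abel

theorem lead_unflatten (hΨ : ∀ v ∈ H, t.lead (Ψ v) = c + v) {z : F} (hz : t.proj z ∈ H) :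
    t.lead (unflatten t Ψ z) - c = t.proj z := by
  rw [unflatten, map_add, hΨ _ hz, t.lead_apply, ContinuousLinearEquiv.apply_symm_apply,
    t.compl_apply, map_sub, t.proj_incl]
  abel

theorem invOn_unflatten_flatten (hΨ : ∀ v ∈ H, t.lead (Ψ v) = c + v) :
    Set.InvOn (unflatten t Ψ) (flatten t Ψ c) (flattenSource t c H) (t.proj ⁻¹' H) := by
  refine ⟨fun w hw => ?_, fun z hz => ?_⟩
  · rw [unflatten, t.compl_apply, proj_flatten hΨ hw]
    simp [flatten]
  · rw [flatten, lead_unflatten hΨ hz]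
    simp [unflatten, t.compl_apply]

theorem isDiffeo_flatten (hε₀ : 0 < ε) (hH : IsOpen H) (hΨ : ∀ v ∈ H, t.lead (Ψ v) = c + v)
    (hΨC : HolderClass ε C (m + 1) Ψ H) :
    IsDiffeo (m + 1) (flatten t Ψ c) (unflatten t Ψ) (flattenSource t c H) (t.proj ⁻¹' H) where
  isOpen_source := isOpen_flattenSource hH
  isOpen_target := hH.preimage t.proj.continuous
  mapsTo _ hw := Set.mem_preimage.2 (Set.mem_of_eq_of_mem (proj_flatten hΨ hw) hw)
  mapsTo_inv _ hz := Set.mem_preimage.2 (Set.mem_of_eq_of_mem (lead_unflatten hΨ hz) hz)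
  invOn := invOn_unflatten_flatten hΨ
  contDiffOn :=
    (t.coord.contDiff.comp_contDiffOn (contDiffOn_id.sub ((hΨC.contDiffOn hε₀ hH).comp
      (contDiff_lead_sub_const t c).contDiffOn fun _ hw => hw))).add
        (t.incl.contDiff.comp (contDiff_lead_sub_const t c)).contDiffOn
  contDiffOn_inv :=
    (t.coord.symm.contDiff.comp t.compl.contDiff).contDiffOn.add
      ((hΨC.contDiffOn hε₀ hH).comp t.proj.contDiff.contDiffOn fun _ hz => hz)

theorem lipClass_flatten (hε₀ : 0 < ε) (hε₁ : ε ≤ 1) (hC : 0 ≤ C) (hH : IsOpen H)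
    (hconv : Convex ℝ H) (hΨC : HolderClass ε C (m + 1) Ψ H) :
    LipClass ε (2 + 1 * compConst ε C (m + 1) 1) (m + 1) (flatten t Ψ c)
      (flattenSource t c H) := by
  have hW : IsOpen (flattenSource t c H) := isOpen_flattenSource hH
  have hmaps : Set.MapsTo (fun w => t.lead w + -c) (flattenSource t c H) H := fun w hw =>
    Set.mem_of_eq_of_mem (sub_eq_add_neg (t.lead w) c).symm hw
  have hcomp := hΨC.comp hε₀ hε₁ hC zero_le_one hW (convex_flattenSource hconv) hH
    (.affine zero_le_one t.lead t.norm_lead_le (-c)) hmaps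
  have hneg : ‖-(t.coord : F →L[ℝ] F)‖ ≤ 1 := (norm_neg _).trans_le t.norm_coord_le
  have hlin : ‖(t.coord : F →L[ℝ] F) + t.incl ∘L t.lead‖ ≤ 2 :=
    (norm_add_le_of_le t.norm_coord_le ((t.incl.opNorm_comp_le _).trans
      (mul_le_one₀ t.norm_incl_le (norm_nonneg _) t.norm_lead_le))).trans_eq one_add_one_eq_two
  have hsplit : flatten t Ψ c = fun w => (((t.coord : F →L[ℝ] F) + t.incl ∘L t.lead) w + -t.incl c)
      + (-(t.coord : F →L[ℝ] F)) (Ψ (t.lead w + -c)) := by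
    ext1 w
    simp only [flatten, map_sub, ContinuousLinearMap.comp_apply, _root_.add_apply,
      _root_.neg_apply, ContinuousLinearEquiv.coe_coe, ← sub_eq_add_neg]
    abel
  rw [hsplit]
  exact .add hW (.affine zero_le_two _ hlin _) (hcomp.clm_comp hW _ hneg).lipClass

end Flatten

section BoundedSets

variable {E F : Type u} [NormedAddCommGroup E] [NormedSpace ℝ E] [NormedAddCommGroup F]
  [NormedSpace ℝ F] {f : E → F} {S T : Set E} {ε C : ℝ} {m : ℕ}

theorem LipClass.isLip_of_isBounded (hε₀ : 0 < ε) (hS : IsOpen S) (hconv : Convex ℝ S)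
    (hf : LipClass ε C (m + 1) f S) (hT : T ⊆ S) (hb : Bornology.IsBounded T) :
    IsLip (m + 1) ε f T := by
  obtain ⟨R, hR⟩ := hb.subset_ball 0
  have hopen : IsOpen (S ∩ Metric.ball 0 R) := hS.inter Metric.isOpen_ball
  have hconv' : Convex ℝ (S ∩ Metric.ball 0 R) := hconv.inter (convex_ball _ _)
  obtain ⟨C', -, hC'⟩ := (hf.mono_set Set.inter_subset_left).exists_holderClass hopen hconv'
    (Metric.isBounded_ball.subset Set.inter_subset_right)
  exact ⟨C', (hC'.isLipWith hε₀ hconv' hopen).mono_set (Set.subset_inter hT hR)⟩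

theorem LipClass.isBounded_image (hS : IsOpen S) (hconv : Convex ℝ S)
    (hb : Bornology.IsBounded S) (hf : LipClass ε C (m + 1) f S) :
    Bornology.IsBounded (f '' S) := by
  obtain ⟨K, -, hK⟩ := hf.exists_holderClass hS hconv hb
  exact isBounded_iff_forall_norm_le.2 ⟨K, Set.forall_mem_image.2 hK.norm_le⟩

end BoundedSets

section Chart

variable {E G : Type u} [NormedAddCommGroup E] [NormedSpace ℝ E] [NormedAddCommGroup G]
  [NormedSpace ℝ G] {s : LeadingCoords E G} {u : E → G} {x₀ x y : E} {ε M₁ M₂ α : ℝ} {m : ℕ}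
  {L : E ≃L[ℝ] E} {κ : E → E}

/-- The part of the ball of radius `α` about `x₀` on which the straightening map, normalised by
`L`, takes values in the ball of radius `α / 2`. -/
def chartSource (s : LeadingCoords E G) (u : E → G) (x₀ : E) (α : ℝ) (L : E ≃L[ℝ] E) : Set E :=
  Metric.ball x₀ α ∩ (fun x => L.symm (straighten s u x₀ x)) ⁻¹' Metric.ball 0 (α / 2)

/-- The image of the ball of radius `r` about the origin under `L`. -/
def chartTarget (L : E ≃L[ℝ] E) (r : ℝ) : Set E := L.symm ⁻¹' Metric.ball 0 r

/-- The inverse of the straightening map, from the inverse `κ` of the map normalised by `L`. -/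
def chartInv (L : E ≃L[ℝ] E) (κ : E → E) (y : E) : E := κ (L.symm y)

theorem isOpen_chartTarget (L : E ≃L[ℝ] E) (r : ℝ) : IsOpen (chartTarget L r) :=
  Metric.isOpen_ball.preimage L.symm.continuous

theorem convex_chartTarget (L : E ≃L[ℝ] E) (r : ℝ) : Convex ℝ (chartTarget L r) :=
  (convex_ball _ _).linear_preimage (L.symm : E →L[ℝ] E).toLinearMap

theorem chartTarget_mono {r r' : ℝ} (h : r ≤ r') : chartTarget L r ⊆ chartTarget L r' :=
  Set.preimage_mono (Metric.ball_subset_ball h)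

theorem chartTarget_half_subset (hα : 0 < α) : chartTarget L (α / 2) ⊆ chartTarget L (2 * α / 3) :=
  chartTarget_mono (by linarith)

theorem add_mem_chartTarget {r r' Λ : ℝ} (hL : ‖(L.symm : E →L[ℝ] E)‖ ≤ Λ)
    (hy : y ∈ chartTarget L r) (hx : Λ * ‖x‖ ≤ r') : y + x ∈ chartTarget L (r + r') := by
  have hx' : ‖L.symm x‖ ≤ r' := ((L.symm : E →L[ℝ] E).le_of_opNorm_le hL x).trans hx
  refine mem_ball_zero_iff.2 ?_
  rw [map_add]
  exact (norm_add_le _ _).trans_lt (add_lt_add_of_lt_of_le (mem_ball_zero_iff.1 hy) hx')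

theorem chartSource_subset_ball : chartSource s u x₀ α L ⊆ Metric.ball x₀ α :=
  Set.inter_subset_left

namespace IsStraightening

theorem isOpen_chartSource (h : IsStraightening ε M₁ M₂ m s u x₀ α L κ) :
    IsOpen (chartSource s u x₀ α L) :=
  (L.symm.continuous.comp_continuousOn h.lipClass.1.continuousOn).isOpen_inter_preimage
    Metric.isOpen_ball Metric.isOpen_ball

theorem ball_subset_chartSource (h : IsStraightening ε M₁ M₂ m s u x₀ α L κ) (hα : 0 < α) :
    Metric.ball x₀ (α / 3) ⊆ chartSource s u x₀ α L := fun x hx => by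
  have hxα : x ∈ Metric.ball x₀ α := Metric.ball_subset_ball (by linarith) hx
  refine ⟨hxα, mem_ball_zero_iff.2 ((h.isBallInverse.norm_apply_le x hxα).trans_lt ?_)⟩
  linarith [mem_ball_iff_norm.1 hx]

theorem mapsTo_chartInv (h : IsStraightening ε M₁ M₂ m s u x₀ α L κ) :
    Set.MapsTo (chartInv L κ) (chartTarget L (2 * α / 3)) (Metric.ball x₀ α) :=
  fun _ hy => h.isBallInverse.mapsTo hy

theorem straighten_chartInv (h : IsStraightening ε M₁ M₂ m s u x₀ α L κ)
    (hy : y ∈ chartTarget L (2 * α / 3)) : straighten s u x₀ (chartInv L κ y) = y :=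
  L.symm.injective (h.isBallInverse.right_inv _ hy)

theorem chartInv_straighten (h : IsStraightening ε M₁ M₂ m s u x₀ α L κ)
    (hx : x ∈ Metric.ball x₀ α) : chartInv L κ (straighten s u x₀ x) = x :=
  h.isBallInverse.left_inv x hx

theorem chartInv_zero (h : IsStraightening ε M₁ M₂ m s u x₀ α L κ) (hα : 0 < α) :
    chartInv L κ 0 = x₀ := by
  simpa only [straighten_self] using h.chartInv_straighten (Metric.mem_ball_self hα)

theorem apply_chartInv (h : IsStraightening ε M₁ M₂ m s u x₀ α L κ)
    (hy : y ∈ chartTarget L (2 * α / 3)) : u (chartInv L κ y) = u x₀ + s.proj y := by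
  rw [← sub_eq_iff_eq_add', ← proj_straighten, h.straighten_chartInv hy]

theorem exists_holderClass_chartInv (h : IsStraightening ε M₁ M₂ m s u x₀ α L κ) (hε₀ : 0 < ε)
    (hε₁ : ε ≤ 1) :
    ∃ C, 0 ≤ C ∧ HolderClass ε C (m + 1) (chartInv L κ) (chartTarget L (2 * α / 3)) := by
  obtain ⟨C, hC, hκ⟩ := h.isBallInverse.lipClass.exists_holderClass Metric.isOpen_ball
    (convex_ball _ _) Metric.isBounded_ball
  have hL : LipClass ε ‖(L.symm : E →L[ℝ] E)‖ (m + 1) L.symm (chartTarget L (2 * α / 3)) := by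
    simpa using! LipClass.affine (norm_nonneg _) (L.symm : E →L[ℝ] E) le_rfl 0
  exact ⟨_, compConst_nonneg hC (norm_nonneg _) _, HolderClass.comp (g := κ) hε₀ hε₁ hC
    (norm_nonneg _) (isOpen_chartTarget L _) (convex_chartTarget L _) Metric.isOpen_ball hκ hL
    fun _ hy => hy⟩

theorem isLipDiffeo (h : IsStraightening ε M₁ M₂ m s u x₀ α L κ) (hε₀ : 0 < ε) (hε₁ : ε ≤ 1)
    (hα : 0 < α) :
    IsLipDiffeo (m + 1) ε (straighten s u x₀) (chartInv L κ) (chartSource s u x₀ α L)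
      (chartTarget L (α / 2)) where
  mapsTo _ hx := hx.2
  mapsTo_inv y hy := by
    have hy' := chartTarget_half_subset hα hy
    refine ⟨h.mapsTo_chartInv hy', ?_⟩
    rwa [Set.mem_preimage, h.straighten_chartInv hy']
  invOn := ⟨fun _ hx => h.chartInv_straighten hx.1,
    fun _ hy => h.straighten_chartInv (chartTarget_half_subset hα hy)⟩
  lip := h.lipClass.isLip_of_isBounded hε₀ Metric.isOpen_ball (convex_ball _ _)
    chartSource_subset_ball (Metric.isBounded_ball.subset chartSource_subset_ball)
  lip_inv := by
    obtain ⟨C, -, hC⟩ := h.exists_holderClass_chartInv hε₀ hε₁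
    exact ⟨C, (hC.isLipWith hε₀ (convex_chartTarget L _) (isOpen_chartTarget L _)).mono_set
      (chartTarget_half_subset hα)⟩

end IsStraightening

end Chart

section NormalForm

variable {E F G : Type u} [NormedAddCommGroup E] [NormedSpace ℝ E] [NormedAddCommGroup F]
  [NormedSpace ℝ F] [NormedAddCommGroup G] [NormedSpace ℝ G] {s : LeadingCoords E G}
  {t : LeadingCoords F G} {φ ν : E → F} {x₀ : E} {ε M₁ M₂ C α : ℝ} {m : ℕ} {L : E ≃L[ℝ] E}
  {κ : E → E} {Ψ : G → F}

/-- The charts `f : U₀ → H` about `x₀` and `g : W → W'` about `φ x₀`, with inverses `f'` and `g'`,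
bring `φ` into the normal form `ν`. The set `U₀` lies between the balls about `x₀` of radii `α / 3`
and `α`. -/
structure IsNormalForm (m : ℕ) (ε : ℝ) (φ ν : E → F) (x₀ : E) (α : ℝ) (U₀ H : Set E)
    (f f' : E → E) (W W' : Set F) (g g' : F → F) : Prop where
  isOpen_source : IsOpen U₀
  isOpen_target : IsOpen H
  ball_subset : Metric.ball x₀ (α / 3) ⊆ U₀
  subset_ball : U₀ ⊆ Metric.ball x₀ α
  isLipDiffeo : IsLipDiffeo (m + 1) ε f f' U₀ H
  map_base : f x₀ = 0
  isDiffeo : IsDiffeo (m + 1) g g' W W'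
  image_subset : φ '' U₀ ⊆ W
  map_image_base : g (φ x₀) = 0
  isLip_fderiv : IsLip m ε (fderiv ℝ g) W
  isBounded_image : Bornology.IsBounded (φ '' U₀)
  isLip_of_isBounded : ∀ S ⊆ W, Bornology.IsBounded S → IsLip (m + 1) ε g S
  normal_form : ∀ x ∈ H, g (φ (f' x)) = ν x

/-- The map `ψ` inverts `φ` on `U₀` from the left; it is defined on an open neighbourhood `V` of
the image, where it is `Lip-(m + 1 + ε)`, and `c` is an admissible constant for its derivative. -/
structure IsLipLeftInverse (m : ℕ) (ε c : ℝ) (φ : E → F) (U₀ : Set E) (V : Set F) (ψ : F → E) :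
    Prop where
  isOpen : IsOpen V
  image_subset : φ '' U₀ ⊆ V
  leftInvOn : Set.LeftInvOn ψ φ U₀
  isLip : IsLip (m + 1) ε ψ V
  differentiableOn : DifferentiableOn ℝ ψ V
  isLipWith_fderiv : IsLipWith m ε c (fderiv ℝ ψ) V

namespace IsStraightening

theorem comp_chartInv_eq_of_proj_eq [FiniteDimensional ℝ F]
    (h : IsStraightening ε M₁ M₂ m s (fun x => t.lead (φ x)) x₀ α L κ) (hε₀ : 0 < ε) (hε₁ : ε ≤ 1)
    (hφ : ∀ x ∈ Metric.ball x₀ α, DifferentiableAt ℝ φ x)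
    (hrank : ∀ x ∈ Metric.ball x₀ α,
      Module.finrank ℝ (LinearMap.range (fderiv ℝ φ x).toLinearMap) ≤ Module.finrank ℝ G) :
    ∀ y ∈ chartTarget L (2 * α / 3), ∀ z ∈ chartTarget L (2 * α / 3),
      s.proj y = s.proj z → φ (chartInv L κ y) = φ (chartInv L κ z) := by
  obtain ⟨K, -, hK⟩ := h.exists_holderClass_chartInv hε₀ hε₁
  have hderiv : ∀ y ∈ chartTarget L (2 * α / 3), HasFDerivAt (fun y => φ (chartInv L κ y))
      (fderiv ℝ φ (chartInv L κ y) ∘L fderiv ℝ (chartInv L κ) y) y := fun y hy =>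
    (hφ _ (h.mapsTo_chartInv hy)).hasFDerivAt.comp y
      (hK.differentiableAt (isOpen_chartTarget L _) hy).hasFDerivAt
  intro y hy z hz
  refine eq_of_proj_eq_of_finrank_range_le (isOpen_chartTarget L _) (convex_chartTarget L _)
    (fun x hx => (hderiv x hx).differentiableAt) (fun x hx => ?_) s.proj_surjective
    (fun x hx => h.apply_chartInv hx) hy hz
  rw [(hderiv x hx).fderiv]
  exact (Submodule.finrank_mono (LinearMap.range_comp_le_range _ _)).trans
    (hrank _ (h.mapsTo_chartInv hx))

theorem exists_factor_comp_chartInv [FiniteDimensional ℝ F]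
    (h : IsStraightening ε M₁ M₂ m s (fun x => t.lead (φ x)) x₀ α L κ) (hε₀ : 0 < ε) (hε₁ : ε ≤ 1)
    (hM₁ : 0 ≤ M₁) (hM₂ : 0 ≤ M₂) (hα : 0 < α)
    (hφ : LipClass ε C (m + 1) φ (Metric.ball x₀ α))
    (hrank : ∀ x ∈ Metric.ball x₀ α,
      Module.finrank ℝ (LinearMap.range (fderiv ℝ φ x).toLinearMap) ≤ Module.finrank ℝ G) :
    ∃ Ψ : G → F, (∀ y ∈ chartTarget L (2 * α / 3), Ψ (s.proj y) = φ (chartInv L κ y)) ∧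
      ∃ C', 0 ≤ C' ∧ HolderClass ε C' (m + 1) Ψ (s.proj '' chartTarget L (α / 2)) := by
  have hT := isOpen_chartTarget L (2 * α / 3)
  have hTconv := convex_chartTarget L (2 * α / 3)
  have hΛ := straightenConst_pos hM₁ hM₂
  obtain ⟨K, hK, hφK⟩ := hφ.exists_holderClass Metric.isOpen_ball (convex_ball _ _)
    Metric.isBounded_ball
  obtain ⟨K', hK', hκK'⟩ := h.exists_holderClass_chartInv hε₀ hε₁
  refine exists_holderClass_factor hε₀ hε₁ (compConst_nonneg hK hK' (m + 1)) hT
    (hφK.comp hε₀ hε₁ hK hK' hT hTconv Metric.isOpen_ball hκK'.lipClass h.mapsTo_chartInv)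
    s.proj_incl (h.comp_chartInv_eq_of_proj_eq hε₀ hε₁
      (fun x hx => hφ.differentiableAt Metric.isOpen_ball hx) hrank)
    (ρ := α / (6 * straightenConst M₁ M₂)) (by positivity) fun y hy d hd => ?_
  rw [lt_div_iff₀ (by positivity)] at hd
  have hincl : straightenConst M₁ M₂ * ‖s.incl d‖ ≤ α / 6 := by
    have := mul_le_mul_of_nonneg_left (s.incl.le_of_opNorm_le s.norm_incl_le d) hΛ.le
    linarith
  exact chartTarget_mono (by linarith) (add_mem_chartTarget h.norm_symm_le hy hincl)

theorem image_subset_flattenSource :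
    φ '' chartSource s (fun x => t.lead (φ x)) x₀ α L ⊆
      flattenSource t (t.lead (φ x₀)) (s.proj '' chartTarget L (α / 2)) := by
  rintro _ ⟨x, hx, rfl⟩
  exact ⟨_, hx.2, proj_straighten s _ x₀ x⟩

theorem lead_factor (h : IsStraightening ε M₁ M₂ m s (fun x => t.lead (φ x)) x₀ α L κ) (hα : 0 < α)
    (hΨ : ∀ y ∈ chartTarget L (2 * α / 3), Ψ (s.proj y) = φ (chartInv L κ y)) :
    ∀ v ∈ s.proj '' chartTarget L (α / 2), t.lead (Ψ v) = t.lead (φ x₀) + v := by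
  rintro _ ⟨y, hy, rfl⟩
  have hy' := chartTarget_half_subset hα hy
  rw [hΨ y hy']
  exact h.apply_chartInv hy'

theorem flatten_comp_chartInv
    (h : IsStraightening ε M₁ M₂ m s (fun x => t.lead (φ x)) x₀ α L κ)
    (hΨ : ∀ y ∈ chartTarget L (2 * α / 3), Ψ (s.proj y) = φ (chartInv L κ y)) {y : E}
    (hy : y ∈ chartTarget L (2 * α / 3)) :
    flatten t Ψ (t.lead (φ x₀)) (φ (chartInv L κ y)) = t.incl (s.proj y) :=
  flatten_eq_incl (h.apply_chartInv hy) (hΨ y hy)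

theorem isNormalForm (h : IsStraightening ε M₁ M₂ m s (fun x => t.lead (φ x)) x₀ α L κ)
    (hε₀ : 0 < ε) (hε₁ : ε ≤ 1) (hα : 0 < α) (hφ : LipClass ε C (m + 1) φ (Metric.ball x₀ α))
    (hΨ : ∀ y ∈ chartTarget L (2 * α / 3), Ψ (s.proj y) = φ (chartInv L κ y)) {C' : ℝ}
    (hC' : 0 ≤ C') (hΨC : HolderClass ε C' (m + 1) Ψ (s.proj '' chartTarget L (α / 2))) :
    IsNormalForm m ε φ (fun y => t.incl (s.proj y)) x₀ α
      (chartSource s (fun x => t.lead (φ x)) x₀ α L) (chartTarget L (α / 2))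
      (straighten s (fun x => t.lead (φ x)) x₀) (chartInv L κ)
      (flattenSource t (t.lead (φ x₀)) (s.proj '' chartTarget L (α / 2)))
      (t.proj ⁻¹' (s.proj '' chartTarget L (α / 2))) (flatten t Ψ (t.lead (φ x₀)))
      (unflatten t Ψ) := by
  have hD := s.isOpenMap_proj _ (isOpen_chartTarget L (α / 2))
  have hconv : Convex ℝ (s.proj '' chartTarget L (α / 2)) :=
    (convex_chartTarget L _).linear_image s.proj.toLinearMap
  have hW := isOpen_flattenSource (t := t) (c := t.lead (φ x₀)) hD
  have hWconv := convex_flattenSource (t := t) (c := t.lead (φ x₀)) hconv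
  have hflat := lipClass_flatten (t := t) (c := t.lead (φ x₀)) hε₀ hε₁ hC' hD hconv hΨC
  have hbase : (0 : E) ∈ chartTarget L (2 * α / 3) := by
    rw [chartTarget, Set.mem_preimage, map_zero]
    exact Metric.mem_ball_self (by positivity)
  exact
    { isOpen_source := h.isOpen_chartSource
      isOpen_target := isOpen_chartTarget L _
      ball_subset := h.ball_subset_chartSource hα
      subset_ball := chartSource_subset_ball
      isLipDiffeo := h.isLipDiffeo hε₀ hε₁ hα
      map_base := straighten_self s _ x₀
      isDiffeo := isDiffeo_flatten hε₀ hD (h.lead_factor hα hΨ) hΨC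
      image_subset := image_subset_flattenSource
      map_image_base := by
        simpa [h.chartInv_zero hα] using h.flatten_comp_chartInv hΨ hbase
      isLip_fderiv := ⟨_, hflat.2.isLipWith hε₀ hWconv hW⟩
      isBounded_image := (hφ.isBounded_image Metric.isOpen_ball (convex_ball _ _)
        Metric.isBounded_ball).subset (Set.image_mono chartSource_subset_ball)
      isLip_of_isBounded := fun _ hS hb => hflat.isLip_of_isBounded hε₀ hW hWconv hS hb
      normal_form := fun _ hy => h.flatten_comp_chartInv hΨ (chartTarget_half_subset hα hy) }

end IsStraightening

/-- The constant of the derivative of the local inverse. -/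
noncomputable def leftInverseConst (ε M₁ M₂ : ℝ) (m : ℕ) : ℝ :=
  2 * 4 ^ m * compConst ε (fderivInverseConst ε 2 m (straightenConst M₁ M₂ * (M₁ + 2))) m
    (2 * straightenConst M₁ M₂) * straightenConst M₁ M₂

/-- The candidate for a left inverse of `φ` near `x₀`: it recovers `x` from the leading coordinates
of `φ x` alone. -/
def leftInv (s : LeadingCoords E G) (t : LeadingCoords F G) (c : G) (L : E ≃L[ℝ] E) (κ : E → E)
    (w : F) : E :=
  chartInv L κ (s.incl (t.lead w - c))

theorem leftInverseConst_nonneg (hM₁ : 0 ≤ M₁) (hM₂ : 0 ≤ M₂) :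
    0 ≤ leftInverseConst ε M₁ M₂ m := by
  have hΛ := straightenConst_pos hM₁ hM₂
  have hK : 0 ≤ fderivInverseConst ε 2 m (straightenConst M₁ M₂ * (M₁ + 2)) :=
    fderivInverseConst_nonneg (by positivity) zero_le_two m
  exact mul_nonneg (mul_nonneg (by positivity) (compConst_nonneg hK (by positivity) m)) hΛ.le

namespace IsStraightening

theorem leftInvOn_leftInv (h : IsStraightening ε M₁ M₂ m s (fun x => t.lead (φ x)) x₀ α L κ)
    (hinj : Function.Injective s.proj) :
    Set.LeftInvOn (leftInv s t (t.lead (φ x₀)) L κ) φ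
      (chartSource s (fun x => t.lead (φ x)) x₀ α L) := fun x hx => by
  have hstraight : s.incl (t.lead (φ x) - t.lead (φ x₀)) =
      straighten s (fun x => t.lead (φ x)) x₀ x :=
    hinj ((s.proj_incl _).trans (proj_straighten s (fun x => t.lead (φ x)) x₀ x).symm)
  rw [leftInv, hstraight, h.chartInv_straighten hx.1]

theorem lipClass_leftInv (h : IsStraightening ε M₁ M₂ m s (fun x => t.lead (φ x)) x₀ α L κ)
    (hε₀ : 0 < ε) (hε₁ : ε ≤ 1) (hM₁ : 0 ≤ M₁) (hM₂ : 0 ≤ M₂) {c : G} {V : Set F}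
    (hV : IsOpen V) (hconv : Convex ℝ V)
    (hmaps : Set.MapsTo (fun w => s.incl (t.lead w - c)) V (chartTarget L (2 * α / 3))) :
    LipClass ε (leftInverseConst ε M₁ M₂ m) (m + 1) (leftInv s t c L κ) V := by
  have hΛ := straightenConst_pos hM₁ hM₂
  let a : F → E := fun w => ((L.symm : E →L[ℝ] E) ∘L s.incl ∘L t.lead) w + -L.symm (s.incl c)
  have ha : (fun w => L.symm (s.incl (t.lead w - c))) = a := by
    ext1 w
    simp [a, sub_eq_add_neg]
  have hnorm : ‖(L.symm : E →L[ℝ] E) ∘L s.incl ∘L t.lead‖ ≤ straightenConst M₁ M₂ :=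
    (ContinuousLinearMap.opNorm_comp_le _ _).trans ((mul_le_mul h.norm_symm_le
      ((ContinuousLinearMap.opNorm_comp_le _ _).trans
        (mul_le_one₀ s.norm_incl_le (norm_nonneg _) t.norm_lead_le))
      (norm_nonneg _) hΛ.le).trans_eq (mul_one _))
  have halip : LipClass ε (straightenConst M₁ M₂) (m + 1) a V := .affine hΛ.le _ hnorm _
  have hamaps : Set.MapsTo a V (Metric.ball 0 (2 * α / 3)) := ha ▸ hmaps
  have hκ := h.isBallInverse.lipClass
  have hK : 0 ≤ fderivInverseConst ε 2 m (straightenConst M₁ M₂ * (M₁ + 2)) :=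
    fderivInverseConst_nonneg (by positivity) zero_le_two m
  rw [show leftInv s t c L κ = fun w => κ (a w) from ha ▸ rfl]
  have hcomp := hκ.2.comp hε₀ hε₁ hK (by positivity) hV hconv Metric.isOpen_ball
    (halip.of_succ hε₀ hε₁ hV hconv) hamaps
  exact ⟨hκ.1.comp halip.1 hamaps,
    hcomp.fderiv_comp hε₀ hε₁ hV hconv Metric.isOpen_ball hκ.1 hamaps halip⟩

theorem isLipLeftInverse (h : IsStraightening ε M₁ M₂ m s (fun x => t.lead (φ x)) x₀ α L κ)
    (hε₀ : 0 < ε) (hε₁ : ε ≤ 1) (hM₁ : 0 ≤ M₁) (hM₂ : 0 ≤ M₂) (hα : 0 < α)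
    (hinj : Function.Injective s.proj) :
    IsLipLeftInverse m ε (leftInverseConst ε M₁ M₂ m) φ
      (chartSource s (fun x => t.lead (φ x)) x₀ α L)
      (flattenSource t (t.lead (φ x₀)) (s.proj '' chartTarget L (α / 2)))
      (leftInv s t (t.lead (φ x₀)) L κ) := by
  have hV := isOpen_flattenSource (t := t) (c := t.lead (φ x₀))
    (s.isOpenMap_proj _ (isOpen_chartTarget L (α / 2)))
  have hVconv := convex_flattenSource (t := t) (c := t.lead (φ x₀))
    ((convex_chartTarget L (α / 2)).linear_image s.proj.toLinearMap)
  have hmaps : Set.MapsTo (fun w => s.incl (t.lead w - t.lead (φ x₀)))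
      (flattenSource t (t.lead (φ x₀)) (s.proj '' chartTarget L (α / 2)))
      (chartTarget L (2 * α / 3)) := by
    rintro w ⟨y, hy, hyw⟩
    have hincl : s.incl (t.lead w - t.lead (φ x₀)) = y := hinj ((s.proj_incl _).trans hyw.symm)
    exact Set.mem_of_eq_of_mem hincl (chartTarget_half_subset hα hy)
  have hlip := h.lipClass_leftInv hε₀ hε₁ hM₁ hM₂ hV hVconv hmaps
  exact
    { isOpen := hV
      image_subset := image_subset_flattenSource
      leftInvOn := h.leftInvOn_leftInv hinj
      isLip := ⟨_, (hlip.holderClass (K := ‖x₀‖ + α) fun w hw =>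
        (norm_lt_of_mem_ball (h.mapsTo_chartInv (hmaps hw))).le).isLipWith hε₀ hVconv hV⟩
      differentiableOn := hlip.1
      isLipWith_fderiv := hlip.2.isLipWith hε₀ hVconv hV }

end IsStraightening

theorem exists_isNormalForm [CompleteSpace E] [FiniteDimensional ℝ F] (hε₀ : 0 < ε) (hε₁ : ε ≤ 1)
    (hM₁ : 0 ≤ M₁) (hM₂ : 0 ≤ M₂) (hα₀ : 0 < α) (hα : α ≤ straightenRadius ε M₁ M₂ m)
    (hφ : LipClass ε M₁ (m + 1) φ (Metric.ball x₀ α))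
    (hrank : ∀ x ∈ Metric.ball x₀ α,
      Module.finrank ℝ (LinearMap.range (fderiv ℝ φ x).toLinearMap) ≤ Module.finrank ℝ G)
    (A : G ≃L[ℝ] G) (hA : ∀ v, t.lead (fderiv ℝ φ x₀ (s.leadIncl v)) = A v)
    (hA' : ‖(A.symm : G →L[ℝ] G)‖ ≤ M₂) :
    ∃ U₀ H f f' W W' g g',
      IsNormalForm m ε φ (fun y => t.incl (s.proj y)) x₀ α U₀ H f f' W W' g g' ∧
        (Function.Injective s.proj →
          ∃ V ψ, IsLipLeftInverse m ε (leftInverseConst ε M₁ M₂ m) φ U₀ V ψ) := by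
  have hu := hφ.clm_comp Metric.isOpen_ball t.lead t.norm_lead_le
  rw [one_mul] at hu
  have hderiv : fderiv ℝ (fun x => t.lead (φ x)) x₀ = t.lead ∘L fderiv ℝ φ x₀ :=
    (t.lead.hasFDerivAt.comp x₀ (hφ.differentiableAt Metric.isOpen_ball
      (Metric.mem_ball_self hα₀)).hasFDerivAt).fderiv
  obtain ⟨L, κ, h⟩ := exists_isStraightening hε₀ hε₁ hM₁ hM₂ hα₀ hα hu A
    (fun v => (DFunLike.congr_fun hderiv _).trans (hA v)) hA'
  obtain ⟨Ψ, hΨ, C, hC, hΨC⟩ := h.exists_factor_comp_chartInv hε₀ hε₁ hM₁ hM₂ hα₀ hφ hrank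
  exact ⟨_, _, _, _, _, _, _, _, h.isNormalForm hε₀ hε₁ hα₀ hφ hΨ hC hΨC,
    fun hinj => ⟨_, _, h.isLipLeftInverse hε₀ hε₁ hM₁ hM₂ hα₀ hinj⟩⟩

end NormalForm

section Coordinates

variable {ι κ : Type*} [Fintype ι] [Fintype κ] {e j : κ → ι}

theorem norm_continuousLinearMap_pi_le_one {E : Type*} [SeminormedAddCommGroup E] [NormedSpace ℝ E]
    (A : E →L[ℝ] (ι → ℝ)) (hA : ∀ x a, ‖A x a‖ ≤ ‖x‖) : ‖A‖ ≤ 1 :=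
  A.opNorm_le_bound zero_le_one fun x => by
    rw [one_mul]
    exact (pi_norm_le_iff_of_nonneg (norm_nonneg _)).2 (hA x)

/-- The coordinates `x (j a)` of `x : ι → ℝ` as leading coordinates, moved to the positions `e a`
by a permutation. -/
noncomputable def LeadingCoords.ofInjective (he : Function.Injective e)
    (hj : Function.Injective j) : LeadingCoords (ι → ℝ) (κ → ℝ) :=
  let σ := (Equiv.Perm.exists_extending_pair e j he hj).choose
  { coord := (LinearEquiv.funCongrLeft ℝ ℝ σ).toContinuousLinearEquiv
    proj := (LinearMap.funLeft ℝ ℝ e).toContinuousLinearMap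
    incl := (Function.ExtendByZero.linearMap ℝ e).toContinuousLinearMap
    proj_incl := fun v => funext fun a => he.extend_apply v 0 a
    norm_coord_le := norm_continuousLinearMap_pi_le_one _ fun x a => norm_le_pi_norm x (σ a)
    norm_coord_symm_le :=
      norm_continuousLinearMap_pi_le_one _ fun x a => norm_le_pi_norm x (σ.symm a)
    norm_proj_le := norm_continuousLinearMap_pi_le_one _ fun x a => norm_le_pi_norm x (e a)
    norm_incl_le := norm_continuousLinearMap_pi_le_one _ fun v a => by
      change ‖Function.extend e v 0 a‖ ≤ ‖v‖
      by_cases ha : ∃ b, e b = a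
      · obtain ⟨b, rfl⟩ := ha
        rw [he.extend_apply]
        exact norm_le_pi_norm v b
      · rw [Function.extend_apply' _ _ _ ha, Pi.zero_apply, norm_zero]
        exact norm_nonneg v }

namespace LeadingCoords

variable (he : Function.Injective e) (hj : Function.Injective j)

theorem incl_ofInjective (v : κ → ℝ) : (ofInjective he hj).incl v = Function.extend e v 0 := rfl

theorem lead_ofInjective (x : ι → ℝ) (a : κ) : (ofInjective he hj).lead x a = x (j a) :=
  congrArg x ((Equiv.Perm.exists_extending_pair e j he hj).choose_spec a)

theorem leadIncl_ofInjective_single [DecidableEq ι] [DecidableEq κ] (b : κ) (r : ℝ) :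
    (ofInjective he hj).leadIncl (Pi.single b r) = Pi.single (j b) r := by
  rw [leadIncl_apply, ContinuousLinearEquiv.symm_apply_eq, incl_ofInjective]
  have hσ := (Equiv.Perm.exists_extending_pair e j he hj).choose_spec
  ext a
  change _ = (Pi.single (j b) r : ι → ℝ) ((Equiv.Perm.exists_extending_pair e j he hj).choose a)
  by_cases ha : ∃ c, e c = a
  · obtain ⟨c, rfl⟩ := ha
    simp only [he.extend_apply, hσ, Pi.single_apply, hj.eq_iff]
  · rw [Function.extend_apply' _ _ _ ha, Pi.single_apply, if_neg, Pi.zero_apply]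
    rw [← hσ b, EmbeddingLike.apply_eq_iff_eq]
    exact fun hab => ha ⟨b, hab.symm⟩

end LeadingCoords

variable {p q k : ℕ}

theorem incl_proj_ofInjective_castLE {i : Fin k → Fin q} {j : Fin k → Fin p}
    (hi : Function.Injective i) (hj : Function.Injective j) (hp : k ≤ p) (hq : k ≤ q)
    (x : Fin p → ℝ) :
    (LeadingCoords.ofInjective (Fin.castLE_injective hq) hi).incl
      ((LeadingCoords.ofInjective (Fin.castLE_injective hp) hj).proj x) = firstCoords p q k x := by
  rw [LeadingCoords.incl_ofInjective]
  ext a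
  by_cases ha : a.1 < k
  · obtain ⟨b, rfl⟩ : ∃ b, Fin.castLE hq b = a := ⟨⟨a, ha⟩, rfl⟩
    rw [(Fin.castLE_injective hq).extend_apply, firstCoords, dif_pos ⟨ha, ha.trans_le hp⟩]
    rfl
  · rw [firstCoords, dif_neg fun h => ha h.1, Function.extend_apply' _ _ _ (by
      rintro ⟨b, rfl⟩
      exact ha b.2), Pi.zero_apply]

variable {φ : (Fin p → ℝ) → (Fin q → ℝ)} {x x₀ : Fin p → ℝ} {i : Fin k → Fin q}
  {j : Fin k → Fin p} {P : Matrix (Fin k) (Fin k) ℝ} {ε M₁ M₂ α : ℝ} {m : ℕ}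

theorem lead_fderiv_leadIncl {d : Fin k → Fin p} {e : Fin k → Fin q} (hd : Function.Injective d)
    (he : Function.Injective e) (hi : Function.Injective i) (hj : Function.Injective j)
    (v : Fin k → ℝ) :
    (LeadingCoords.ofInjective he hi).lead
        (fderiv ℝ φ x ((LeadingCoords.ofInjective hd hj).leadIncl v)) =
      (jacobianMinor φ x i j).mulVec v := by
  let B := ((LeadingCoords.ofInjective he hi).lead ∘L fderiv ℝ φ x ∘L
    (LeadingCoords.ofInjective hd hj).leadIncl).toLinearMap
  suffices LinearMap.toMatrix' B = jacobianMinor φ x i j by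
    rw [← this, LinearMap.toMatrix'_mulVec]
    rfl
  ext r l
  rw [LinearMap.toMatrix'_apply]
  exact (LeadingCoords.lead_ofInjective he hi _ r).trans (congrArg (fderiv ℝ φ x · (i r))
    (LeadingCoords.leadIncl_ofInjective_single hd hj l 1))

theorem subordinateNorm_jacobianMinor_le (hi : Function.Injective i) (hj : Function.Injective j) :
    subordinateNorm (jacobianMinor φ x i j) ≤ ‖fderiv ℝ φ x‖ := by
  refine ContinuousLinearMap.opNorm_le_bound _ (norm_nonneg _) fun v => ?_
  have hv : ‖(LeadingCoords.ofInjective hj hj).leadIncl v‖ ≤ ‖v‖ :=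
    (ContinuousLinearMap.le_of_opNorm_le _ (LeadingCoords.norm_leadIncl_le _) v).trans_eq
      (one_mul _)
  have hlead := ContinuousLinearMap.le_of_opNorm_le _
    (LeadingCoords.norm_lead_le (.ofInjective hi hi))
    (fderiv ℝ φ x ((LeadingCoords.ofInjective hj hj).leadIncl v))
  rw [lead_fderiv_leadIncl, one_mul] at hlead
  exact hlead.trans ((fderiv ℝ φ x).le_opNorm_of_le hv)

theorem exists_equiv_mulVec (hP : IsUnit P) :
    ∃ A : (Fin k → ℝ) ≃L[ℝ] (Fin k → ℝ), (∀ v, A v = P.mulVec v) ∧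
      ‖(A : (Fin k → ℝ) →L[ℝ] (Fin k → ℝ))‖ = subordinateNorm P ∧
        ‖(A.symm : (Fin k → ℝ) →L[ℝ] (Fin k → ℝ))‖ = subordinateNorm P⁻¹ := by
  let := hP.invertible
  refine ⟨(P.toLinearEquiv' inferInstance).toContinuousLinearEquiv, fun v => rfl, rfl, ?_⟩
  rw [← Matrix.invOf_eq_nonsing_inv]
  rfl

theorem one_le_mul_norm_fderiv (hk : 0 < k) (hi : Function.Injective i) (hj : Function.Injective j)
    (hP : IsUnit (jacobianMinor φ x i j)) (hP' : subordinateNorm (jacobianMinor φ x i j)⁻¹ ≤ M₂) :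
    1 ≤ M₂ * ‖fderiv ℝ φ x‖ := by
  have : Nonempty (Fin k) := ⟨⟨0, hk⟩⟩
  obtain ⟨A, -, hA, hA'⟩ := exists_equiv_mulVec hP
  calc 1 ≤ ‖(A : (Fin k → ℝ) →L[ℝ] (Fin k → ℝ))‖ * ‖(A.symm : (Fin k → ℝ) →L[ℝ] (Fin k → ℝ))‖ :=
        A.one_le_norm_mul_norm_symm
    _ ≤ ‖fderiv ℝ φ x‖ * M₂ :=
        mul_le_mul (hA.trans_le (subordinateNorm_jacobianMinor_le hi hj)) (hA'.trans_le hP')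
          (norm_nonneg _) (norm_nonneg _)
    _ = M₂ * ‖fderiv ℝ φ x‖ := mul_comm _ _

theorem one_le_mul_lipNorm_fderiv {U : Set (Fin p → ℝ)} (hM₂ : 0 ≤ M₂) (hx : x ∈ U)
    (hφ : IsLip m ε (fderiv ℝ φ) U) (hk : 0 < k) (hi : Function.Injective i)
    (hj : Function.Injective j) (hP : IsUnit (jacobianMinor φ x i j))
    (hP' : subordinateNorm (jacobianMinor φ x i j)⁻¹ ≤ M₂) :
    1 ≤ M₂ * lipNorm m ε (fderiv ℝ φ) U :=
  (one_le_mul_norm_fderiv hk hi hj hP hP').trans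
    (mul_le_mul_of_nonneg_left (hφ.norm_le_lipNorm hx) hM₂)

theorem exists_isNormalForm_firstCoords (hε₀ : 0 < ε) (hε₁ : ε ≤ 1) (hM₁ : 0 ≤ M₁) (hM₂ : 0 ≤ M₂)
    (hα₀ : 0 < α) (hα : α ≤ straightenRadius ε M₁ M₂ m)
    (hφ : LipClass ε M₁ (m + 1) φ (Metric.ball x₀ α))
    (hrank : ∀ x ∈ Metric.ball x₀ α,
      Module.finrank ℝ (LinearMap.range (fderiv ℝ φ x).toLinearMap) ≤ k)
    (hi : Function.Injective i) (hj : Function.Injective j)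
    (hP : IsUnit (jacobianMinor φ x₀ i j))
    (hP' : subordinateNorm (jacobianMinor φ x₀ i j)⁻¹ ≤ M₂) :
    ∃ U₀ H f f' W W' g g',
      IsNormalForm m ε φ (firstCoords p q k) x₀ α U₀ H f f' W W' g g' ∧
        (k = p → ∃ V ψ, IsLipLeftInverse m ε (leftInverseConst ε M₁ M₂ m) φ U₀ V ψ) := by
  have hp : k ≤ p := by simpa using Fintype.card_le_of_injective j hj
  have hq : k ≤ q := by simpa using Fintype.card_le_of_injective i hi
  obtain ⟨A, hA, -, hA'⟩ := exists_equiv_mulVec hP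
  let s := LeadingCoords.ofInjective (Fin.castLE_injective hp) hj
  let t := LeadingCoords.ofInjective (Fin.castLE_injective hq) hi
  obtain ⟨U₀, H, f, f', W, W', g, g', hnormal, hleft⟩ :=
    exists_isNormalForm (s := s) (t := t) hε₀ hε₁ hM₁ hM₂ hα₀ hα hφ
      (fun x hx => (hrank x hx).trans_eq (Module.finrank_fin_fun ℝ).symm) A
      (fun v => (lead_fderiv_leadIncl _ _ hi hj v).trans (hA v).symm) (hA'.trans_le hP')
  have hν : (fun x => t.incl (s.proj x)) = firstCoords p q k :=
    funext (incl_proj_ofInjective_castLE hi hj hp hq)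
  refine ⟨U₀, H, f, f', W, W', g, g', hν ▸ hnormal, fun hkp => hleft fun x y hxy => ?_⟩
  subst hkp
  exact funext (congrFun hxy)

end Coordinates

theorem injective_of_finrank_range_eq {K V V' : Type*} [DivisionRing K] [AddCommGroup V]
    [Module K V] [AddCommGroup V'] [Module K V'] [FiniteDimensional K V] {A : V →ₗ[K] V'}
    (h : Module.finrank K (LinearMap.range A) = Module.finrank K V) : Function.Injective A := by
  have hker := A.finrank_range_add_finrank_ker
  exact LinearMap.ker_eq_bot.1 (Submodule.finrank_eq_zero.1 (by lia))

theorem mainTheorem8 (n : ℕ) (hn : 1 ≤ n) (ε : ℝ) (hε₀ : 0 < ε) (hε₁ : ε ≤ 1)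
    (M₁ M₂ : ℝ) (hM₁ : 0 < M₁) (hM₂ : 0 < M₂) :
    ∃ δ c : ℝ, 0 < δ ∧ 0 < c ∧
      ∀ (p q k : ℕ), 1 ≤ p → 1 ≤ q →
      ∀ (U : Set (Fin p → ℝ)) (φ : (Fin p → ℝ) → (Fin q → ℝ)) (x₀ : Fin p → ℝ)
        (i : Fin k → Fin q) (j : Fin k → Fin p),
        IsOpen U → x₀ ∈ U →
        DifferentiableOn ℝ φ U →
        (∀ x ∈ U, Module.finrank ℝ (LinearMap.range (fderiv ℝ φ x).toLinearMap) = k) →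
        IsLip (n - 1) ε (fderiv ℝ φ) U →
        StrictMono i → StrictMono j →
        IsUnit (jacobianMinor φ x₀ i j) →
        lipNorm (n - 1) ε (fderiv ℝ φ) U ≤ M₁ →
        subordinateNorm (jacobianMinor φ x₀ i j)⁻¹ ≤ M₂ →
        ∀ α : ℝ, 0 < α → α ≤ δ → closure (Metric.ball x₀ α) ⊆ U →
        ∃ (U₀ H : Set (Fin p → ℝ)) (f f' : (Fin p → ℝ) → (Fin p → ℝ))
          (W W' : Set (Fin q → ℝ)) (g g' : (Fin q → ℝ) → (Fin q → ℝ)),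
          -- the diffeomorphism `f : U₀ → H`, with inverse `f'`
          IsOpen U₀ ∧ IsOpen H ∧ Metric.ball x₀ (α / 3) ⊆ U₀ ∧ U₀ ⊆ U ∧
          IsLipDiffeo n ε f f' U₀ H ∧ f x₀ = 0 ∧
          -- the diffeomorphism `g : W → W'`, with inverse `g'`
          IsDiffeo n g g' W W' ∧ φ '' U₀ ⊆ W ∧ g (φ x₀) = 0 ∧
          IsLip (n - 1) ε (fderiv ℝ g) W ∧
          IsLip n ε g (φ '' U₀) ∧
          (∀ S ⊆ W, Bornology.IsBounded S → IsLip n ε g S) ∧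
          -- the normal form
          (∀ x ∈ H, g (φ (f' x)) = firstCoords p q k x) ∧
          -- the case of maximal rank `k = p`
          (k = p →
            Set.InjOn φ U₀ ∧
            (∀ x ∈ U₀, Function.Injective (fderiv ℝ φ x)) ∧
            ∃ (V : Set (Fin q → ℝ)) (ψ : (Fin q → ℝ) → (Fin p → ℝ)),
              IsOpen V ∧ φ '' U₀ ⊆ V ∧
              Set.LeftInvOn ψ φ U₀ ∧
              IsLip n ε ψ V ∧
              DifferentiableOn ℝ ψ V ∧
              IsLip (n - 1) ε (fderiv ℝ ψ) V ∧
              lipNorm (n - 1) ε (fderiv ℝ ψ) V ≤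
                c * lipNorm (n - 1) ε (fderiv ℝ φ) U) := by
  obtain ⟨m, rfl⟩ := Nat.exists_eq_add_of_le' hn
  have hM₁' : 0 ≤ M₁ + 1 := by positivity
  have hc := leftInverseConst_nonneg (ε := ε) (m := m) hM₁' hM₂.le
  refine ⟨straightenRadius ε (M₁ + 1) M₂ m, (leftInverseConst ε (M₁ + 1) M₂ m + 1) * M₂,
    straightenRadius_pos hM₁' hM₂.le, by positivity, ?_⟩
  intro p q k hp _ U φ x₀ i j hU hx₀ hφ hrank hlip hi hj hP hM₁φ hP' α hα₀ hα hball
  have hαU := subset_closure.trans hball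
  have hφ' : LipClass ε (M₁ + 1) (m + 1) φ U :=
    ⟨hφ, (hlip.isLipWith_of_lipNorm_lt hx₀ (by linarith)).holderClass hε₀ hU⟩
  obtain ⟨U₀, H, f, f', W, W', g, g', h, hleft⟩ := exists_isNormalForm_firstCoords hε₀ hε₁ hM₁'
    hM₂.le hα₀ hα (hφ'.mono_set hαU) (fun x hx => (hrank x (hαU hx)).le) hi.injective hj.injective
    hP hP'
  have hU₀ := h.subset_ball.trans hαU
  refine ⟨U₀, H, f, f', W, W', g, g', h.isOpen_source, h.isOpen_target, h.ball_subset, hU₀,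
    h.isLipDiffeo, h.map_base, h.isDiffeo, h.image_subset, h.map_image_base, h.isLip_fderiv,
    h.isLip_of_isBounded _ h.image_subset h.isBounded_image, h.isLip_of_isBounded, h.normal_form,
    fun hkp => ?_⟩
  obtain ⟨V, ψ, hψ⟩ := hleft hkp
  refine ⟨hψ.leftInvOn.injOn, fun x hx => injective_of_finrank_range_eq <| by
      rw [hrank x (hU₀ hx), hkp, Module.finrank_fin_fun],
    V, ψ, hψ.isOpen, hψ.image_subset, hψ.leftInvOn, hψ.isLip, hψ.differentiableOn,
    ⟨_, hψ.isLipWith_fderiv⟩, (hψ.isLipWith_fderiv.lipNorm_le hc).trans ?_⟩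
  have hone := one_le_mul_lipNorm_fderiv hM₂.le hx₀ hlip (by omega) hi.injective hj.injective hP hP'
  rw [mul_assoc]
  exact (le_add_of_nonneg_right zero_le_one).trans (le_mul_of_one_le_right (by positivity) hone)
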